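/- **Language.** The finite types are $0$ (natural numbers) and $\sigma\to\tau$ for finite types $\sigma,\tau$; put $1=0\to 0$ and $n+1=n\to 0$. The language of higher-order arithmetic is many-sorted classical predicate logic with variables of every finite type, function application, constants $0,1$ of type $0$ and $+,\times$ on type $0$, relations $=_0$ and $<_0$ between terms of type $0$, combinators $\Pi_{\rho,\sigma}$, $\Sigma_{\rho,\sigma,\tau}$, and recursor constants $\mathbf R_\sigma$ of type $(\sigma\to\sigma)\to\sigma\to 0\to\sigma$. For $\tau=\tau_1\to\dots\to\tau_k\to 0$, $x=_\tau y$ abbreviates $\forall z_1^{\tau_1}\cdots z_k^{\tau_k}\,(xz_1\cdots z_k=_0 yz_1\cdots z_k)$, and $x\le_\tau y$ is defined likewise from $\le_0$; $1$ also denotes the functional of the relevant type that is constantly $1$. A formula is quantifier-free if it contains no quantifiers; variables of any type may occur in it. **Base theory.** $\mathsf{QF\text{-}AC}^{\sigma,\tau}$ is the schema $\forall x^\sigma\exists y^\tau A(x,y)\to\exists Y^{\sigma\to\tau}\forall x^\sigma A(x,Y(x))$ for quantifier-free $A$ (with parameters). $\mathsf{RCA}_0^\omega$ has the axioms: $0,1,+,\times,<_0$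 form a (discretely) ordered commutative semi-ring with least element $0$; $\Pi xy=x$ and $\Sigma xyz=xz(yz)$; $\mathbf R_0(f,m,0)=m$ and $\mathbf R_0(f,m,n+1)=f(\mathbf R_0(f,m,n))$ for $f^1$ and $m^0,n^0$; extensionality $x=_\rho y\to\varphi(x)=_\tau\varphi(y)$ for all $\rho,\tau$ and $\varphi^{\rho\to\tau}$; induction for quantifier-free formulas; and $\mathsf{QF\text{-}AC}^{1,0}$. **Principles.** Write $\overline f n$ for the code of $\langle f(0),\dots,f(n-1)\rangle$, and $f\in C$ for $f^1\le_1 1$. - $(\exists^2)$: $\exists\varphi^2\le_2 1\ \forall f^1\,[\exists n^0\,(f(n)=0)\leftrightarrow\varphi(f)=0]$. - $(S^2)$: $\exists S^2\le_2 1\ \forall f^1\,[\exists g^1\forall n^0\,(f(\overline g n)=0)\leftrightarrow S(f)=0]$. - $(\exists^3)$: $\exists E^3\le_3 1\ \forall Y^2\,[\exists f^1\,(Y(f)=0)\leftrightarrow E(Y)=0]$. - $(\kappa_0^3)$: $\exists\kappa_0^3\,\forall Y^2\,[\kappa_0(Y)=0\leftrightarrow\exists f\in C\,(Y(f)>0)]$.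 - $\mathsf{MUC}$ (the intuitionistic fan functional): $\exists\Omega^3\,\forall Y^2\,\forall f,g\in C\,(\overline f\,\Omega(Y)=\overline g\,\Omega(Y)\to Y(f)=Y(g))$. - $\mathsf{WKL}$: every infinite binary tree (an infinite set of codes of finite binary sequences that is closed under initial segments) has a path, i.e. an $f\in C$ all of whose initial segments $\overline f n$ lie in the tree. **Theorem.** The system $\mathsf{RCA}_0^\omega+\mathsf{QF\text{-}AC}^{2,0}$ proves $$\mathsf{MUC}\leftrightarrow\big[(\kappa_0^3)\wedge\mathsf{WKL}\wedge\neg(\exists^2)\big]\leftrightarrow\big[(\kappa_0^3)\wedge\mathsf{WKL}\wedge\neg(S^2)\big]\leftrightarrow\big[(\kappa_0^3)\wedge\mathsf{WKL}\wedge\neg(\exists^3)\big],$$ that is, it proves each of these three equivalences. -/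

import Mathlib

/-! # Higher-order arithmetic in all finite types

A deep embedding of the language of all finite types, classical many-sorted predicate logic over
it, and the axioms of the base theory of higher-order Reverse Mathematics.
Variables are typed de Bruijn indices; a context lists the types of the free variables. -/

namespace HOArith

/-- The finite types: `0`, the type of numbers, and `σ → τ`. -/
inductive FinType : Type
  | nat : FinType
  | arr : FinType → FinType → FinType

infixr:60 " ⇾ " => FinType.arr

/-- The type `0`. -/
abbrev T0 : FinType := FinType.nat
/-- The type `1 = 0 → 0`. -/
abbrev T1 : FinType := T0 ⇾ T0
/-- The type `2 = 1 → 0`. -/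
abbrev T2 : FinType := T1 ⇾ T0
/-- The type `3 = 2 → 0`. -/
abbrev T3 : FinType := T2 ⇾ T0

/-- A context: the types of the free variables, the most recently bound one first. -/
abbrev Ctx : Type := List FinType

/-- `Var Γ σ`: the variables of type `σ` in the context `Γ`. -/
inductive Var : Ctx → FinType → Type
  | here {Γ : Ctx} {σ : FinType} : Var (σ :: Γ) σ
  | there {Γ : Ctx} {σ τ : FinType} : Var Γ σ → Var (τ :: Γ) σ

/-- The constants of the language: `0`, `1`, `+`, `×`, the combinators `Π` and `Σ`, and the
recursors `R_σ`. -/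
inductive Const : FinType → Type
  | zero : Const T0
  | one : Const T0
  | add : Const (T0 ⇾ T0 ⇾ T0)
  | mul : Const (T0 ⇾ T0 ⇾ T0)
  | combPi (ρ σ : FinType) : Const (ρ ⇾ σ ⇾ ρ)
  | combSigma (ρ σ τ : FinType) : Const ((ρ ⇾ σ ⇾ τ) ⇾ (ρ ⇾ σ) ⇾ ρ ⇾ τ)
  | recursor (σ : FinType) : Const ((σ ⇾ σ) ⇾ σ ⇾ T0 ⇾ σ)

/-- `Term Γ σ`: the terms of type `σ` with free variables from `Γ`. -/
inductive Term : Ctx → FinType → Type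
  | var {Γ : Ctx} {σ : FinType} : Var Γ σ → Term Γ σ
  | const {Γ : Ctx} {σ : FinType} : Const σ → Term Γ σ
  | app {Γ : Ctx} {σ τ : FinType} : Term Γ (σ ⇾ τ) → Term Γ σ → Term Γ τ

infixl:90 " ⬝ " => Term.app

/-- `Formula Γ`: the formulas with free variables from `Γ`. The atomic formulas are `s =₀ t` and
`s <₀ t` with terms of type `0`; the other connectives are defined classically below. -/
inductive Formula : Ctx → Type
  | falsum {Γ : Ctx} : Formula Γ
  | eq {Γ : Ctx} : Term Γ T0 → Term Γ T0 → Formula Γ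
  | lt {Γ : Ctx} : Term Γ T0 → Term Γ T0 → Formula Γ
  | imp {Γ : Ctx} : Formula Γ → Formula Γ → Formula Γ
  | all {Γ : Ctx} (σ : FinType) : Formula (σ :: Γ) → Formula Γ

infix:50 " ≐ " => Formula.eq

/-- A sentence is a formula without free variables. -/
abbrev Sentence : Type := Formula []

/-! ## Renaming and substitution -/

/-- Renamings of variables. -/
abbrev Ren (Γ Δ : Ctx) : Type := ∀ σ : FinType, Var Γ σ → Var Δ σ

/-- Simultaneous substitutions of terms for variables. -/
abbrev Subst (Γ Δ : Ctx) : Type := ∀ σ : FinType, Var Γ σ → Term Δ σ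

/-- Extend a renaming under a binder. -/
def Ren.lift {Γ Δ : Ctx} (r : Ren Γ Δ) (τ : FinType) : Ren (τ :: Γ) (τ :: Δ)
  | _, Var.here => Var.here
  | _, Var.there x => Var.there (r _ x)

/-- Rename the variables of a term. -/
def Term.rename {Γ Δ : Ctx} (r : Ren Γ Δ) : {σ : FinType} → Term Γ σ → Term Δ σ
  | _, .var x => .var (r _ x)
  | _, .const c => .const c
  | _, .app t u => .app (t.rename r) (u.rename r)

/-- Weakening: regard a term over `Γ` as a term over `τ :: Γ`. -/
def Term.wk {Γ : Ctx} {σ τ : FinType} (t : Term Γ σ) : Term (τ :: Γ) σ :=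
  t.rename (fun _ x => Var.there x)

/-- Rename the free variables of a formula. -/
def Formula.rename : {Γ Δ : Ctx} → Ren Γ Δ → Formula Γ → Formula Δ
  | _, _, _, .falsum => .falsum
  | _, _, r, .eq t u => .eq (t.rename r) (u.rename r)
  | _, _, r, .lt t u => .lt (t.rename r) (u.rename r)
  | _, _, r, .imp A B => .imp (A.rename r) (B.rename r)
  | _, _, r, .all σ A => .all σ (A.rename (r.lift σ))

/-- Weakening: regard a formula over `Γ` as a formula over `τ :: Γ`. -/
def Formula.wk {Γ : Ctx} {τ : FinType} (A : Formula Γ) : Formula (τ :: Γ) :=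
  A.rename (fun _ x => Var.there x)

/-- Extend a substitution under a binder. -/
def Subst.lift {Γ Δ : Ctx} (s : Subst Γ Δ) (τ : FinType) : Subst (τ :: Γ) (τ :: Δ)
  | _, Var.here => Term.var Var.here
  | _, Var.there x => (s _ x).wk

/-- Apply a substitution to a term. -/
def Term.subst {Γ Δ : Ctx} (s : Subst Γ Δ) : {σ : FinType} → Term Γ σ → Term Δ σ
  | _, .var x => s _ x
  | _, .const c => .const c
  | _, .app t u => .app (t.subst s) (u.subst s)

/-- Apply a (capture-avoiding) substitution to a formula. -/
def Formula.subst : {Γ Δ : Ctx} → Subst Γ Δ → Formula Γ → Formula Δ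
  | _, _, _, .falsum => .falsum
  | _, _, s, .eq t u => .eq (t.subst s) (u.subst s)
  | _, _, s, .lt t u => .lt (t.subst s) (u.subst s)
  | _, _, s, .imp A B => .imp (A.subst s) (B.subst s)
  | _, _, s, .all σ A => .all σ (A.subst (s.lift σ))

/-- Extend a substitution by a term for the most recently bound variable. -/
def Subst.cons {Γ Δ : Ctx} {τ : FinType} (t : Term Δ τ) (s : Subst Γ Δ) : Subst (τ :: Γ) Δ
  | _, Var.here => t
  | _, Var.there x => s _ x

/-- `A.inst t` is `A(t)`, where `A = A(x)` and `x` is the most recently bound variable. -/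
def Formula.inst {Γ : Ctx} {τ : FinType} (A : Formula (τ :: Γ)) (t : Term Γ τ) : Formula Γ :=
  A.subst (Subst.cons t (fun _ x => Term.var x))

/-! ## Defined connectives and term notation -/

namespace Formula

variable {Γ : Ctx}

/-- Negation. -/
def neg (A : Formula Γ) : Formula Γ := A.imp falsum
/-- Conjunction. -/
def and (A B : Formula Γ) : Formula Γ := (A.imp B.neg).neg
/-- Disjunction. -/
def or (A B : Formula Γ) : Formula Γ := A.neg.imp B
/-- Equivalence. -/
def iff (A B : Formula Γ) : Formula Γ := (A.imp B).and (B.imp A)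
/-- Existential quantification. -/
def ex (σ : FinType) (A : Formula (σ :: Γ)) : Formula Γ := (all σ A.neg).neg

/-- Quantifier-free formulas (variables of every finite type are allowed). -/
def IsQF : {Γ : Ctx} → Formula Γ → Prop
  | _, falsum => True
  | _, eq _ _ => True
  | _, lt _ _ => True
  | _, imp A B => A.IsQF ∧ B.IsQF
  | _, all _ _ => False

end Formula

section Terms

variable {Γ : Ctx}

/-- The variable bound by the innermost quantifier. -/
abbrev v0 {a : FinType} : Term (a :: Γ) a := .var .here
/-- The variable bound by the second innermost quantifier. -/
abbrev v1 {a b : FinType} : Term (a :: b :: Γ) b := .var (.there .here)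
/-- The variable bound by the third innermost quantifier. -/
abbrev v2 {a b c : FinType} : Term (a :: b :: c :: Γ) c := .var (.there (.there .here))
/-- The variable bound by the fourth innermost quantifier. -/
abbrev v3 {a b c d : FinType} : Term (a :: b :: c :: d :: Γ) d :=
  .var (.there (.there (.there .here)))

/-- The term `0`. -/
def zero : Term Γ T0 := .const .zero
/-- The term `1`. -/
def one : Term Γ T0 := .const .one
/-- The term `x + y`. -/
def add (x y : Term Γ T0) : Term Γ T0 := .const .add ⬝ x ⬝ y
/-- The term `x × y`. -/
def mul (x y : Term Γ T0) : Term Γ T0 := .const .mul ⬝ x ⬝ y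

/-- `x ≤₀ y`. -/
def le (x y : Term Γ T0) : Formula Γ := (Formula.lt x y).or (x ≐ y)

end Terms

/-- `x =_τ y`, defined as `x z₁ … z_k =₀ y z₁ … z_k` for all `z₁, …, z_k`. -/
def eqAt : {Γ : Ctx} → (τ : FinType) → Term Γ τ → Term Γ τ → Formula Γ
  | _, .nat, x, y => x ≐ y
  | _, .arr σ τ, x, y => .all σ (eqAt τ (x.wk ⬝ v0) (y.wk ⬝ v0))

/-- `x ≤_τ y`, defined as `x z₁ … z_k ≤₀ y z₁ … z_k` for all `z₁, …, z_k`. -/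
def leAt : {Γ : Ctx} → (τ : FinType) → Term Γ τ → Term Γ τ → Formula Γ
  | _, .nat, x, y => le x y
  | _, .arr σ τ, x, y => .all σ (leAt τ (x.wk ⬝ v0) (y.wk ⬝ v0))

/-- The functional of type `τ` with constant value `1`. -/
def oneAt {Γ : Ctx} : (τ : FinType) → Term Γ τ
  | .nat => one
  | .arr σ τ => .const (.combPi τ σ) ⬝ oneAt τ

/-! ## Classical provability -/

/-- A set of axioms; an axiom may have free variables, which act as universally quantified. -/
abbrev Axioms : Type := ∀ Γ : Ctx, Formula Γ → Prop

/-- Natural deduction for classical many-sorted predicate logic with equality at type `0`: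
`Derives T Γ H A` says that `A` is derivable from the axioms `T` and the hypotheses `H`,
all in the context `Γ`. -/
inductive Derives (T : Axioms) : (Γ : Ctx) → List (Formula Γ) → Formula Γ → Prop
  | ax {Γ : Ctx} {H : List (Formula Γ)} {A : Formula Γ} : T Γ A → Derives T Γ H A
  | hyp {Γ : Ctx} {H : List (Formula Γ)} {A : Formula Γ} : A ∈ H → Derives T Γ H A
  | impI {Γ : Ctx} {H : List (Formula Γ)} {A B : Formula Γ} :
      Derives T Γ (A :: H) B → Derives T Γ H (A.imp B)
  | impE {Γ : Ctx} {H : List (Formula Γ)} {A B : Formula Γ} :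
      Derives T Γ H (A.imp B) → Derives T Γ H A → Derives T Γ H B
  | byContra {Γ : Ctx} {H : List (Formula Γ)} {A : Formula Γ} :
      Derives T Γ (A.neg :: H) .falsum → Derives T Γ H A
  | allI {Γ : Ctx} {H : List (Formula Γ)} {σ : FinType} {A : Formula (σ :: Γ)} :
      Derives T (σ :: Γ) (H.map Formula.wk) A → Derives T Γ H (.all σ A)
  | allE {Γ : Ctx} {H : List (Formula Γ)} {σ : FinType} {A : Formula (σ :: Γ)} (t : Term Γ σ) :
      Derives T Γ H (.all σ A) → Derives T Γ H (A.inst t)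
  | eqRefl {Γ : Ctx} {H : List (Formula Γ)} (t : Term Γ T0) : Derives T Γ H (t ≐ t)
  | eqSubst {Γ : Ctx} {H : List (Formula Γ)} (A : Formula (T0 :: Γ)) {t u : Term Γ T0} :
      Derives T Γ H (t ≐ u) → Derives T Γ H (A.inst t) → Derives T Γ H (A.inst u)

/-- The axiom system `T` proves the sentence `A`. -/
def Proves (T : Axioms) (A : Sentence) : Prop := Derives T [] [] A

/-! ## The base theory -/

/-- For `A = A(x, y)` with `x` of type `σ` and `y` of type `τ`, the formula `A(x, Y(x))`
with `Y` of type `σ → τ`, in the context of `x`, `Y` and the parameters. -/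
def choiceInst {Γ : Ctx} {σ τ : FinType} (A : Formula (τ :: σ :: Γ)) :
    Formula (σ :: (σ ⇾ τ) :: Γ) :=
  A.subst (Subst.cons (v1 ⬝ v0) (Subst.cons v0 (fun _ x => .var (.there (.there x)))))

/-- The instances of the quantifier-free axiom of choice `QF-AC^{σ,τ}`:
`∀ x^σ ∃ y^τ A(x, y) → ∃ Y^{σ → τ} ∀ x^σ A(x, Y(x))` for quantifier-free `A`. -/
inductive QFAC (σ τ : FinType) : Axioms
  | mk {Γ : Ctx} (A : Formula (τ :: σ :: Γ)) (hA : A.IsQF) :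
      QFAC σ τ Γ ((Formula.all σ (.ex τ A)).imp (.ex (σ ⇾ τ) (.all σ (choiceInst A))))

/-- For `A = A(n)`, the formula `A(n + 1)`. -/
def succInst {Γ : Ctx} (A : Formula (T0 :: Γ)) : Formula (T0 :: Γ) :=
  A.subst (Subst.cons (add v0 one) (fun _ x => .var (.there x)))

open Formula in
/-- The axioms of `RCA₀^ω`. Axioms are given for arbitrary terms in place of universally
quantified variables. -/
inductive RCA0w : Axioms
  -- `0, 1, +, ×, <` form a (discretely) ordered commutative semi-ring with least element `0`
  | add_assoc {Γ : Ctx} (x y z : Term Γ T0) : RCA0w Γ (add (add x y) z ≐ add x (add y z))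
  | add_comm {Γ : Ctx} (x y : Term Γ T0) : RCA0w Γ (add x y ≐ add y x)
  | add_zero {Γ : Ctx} (x : Term Γ T0) : RCA0w Γ (add x zero ≐ x)
  | mul_assoc {Γ : Ctx} (x y z : Term Γ T0) : RCA0w Γ (mul (mul x y) z ≐ mul x (mul y z))
  | mul_comm {Γ : Ctx} (x y : Term Γ T0) : RCA0w Γ (mul x y ≐ mul y x)
  | mul_one {Γ : Ctx} (x : Term Γ T0) : RCA0w Γ (mul x one ≐ x)
  | mul_zero {Γ : Ctx} (x : Term Γ T0) : RCA0w Γ (mul x zero ≐ zero)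
  | mul_add {Γ : Ctx} (x y z : Term Γ T0) :
      RCA0w Γ (mul x (add y z) ≐ add (mul x y) (mul x z))
  | lt_irrefl {Γ : Ctx} (x : Term Γ T0) : RCA0w Γ (lt x x).neg
  | lt_trans {Γ : Ctx} (x y z : Term Γ T0) :
      RCA0w Γ ((lt x y).imp ((lt y z).imp (lt x z)))
  | lt_total {Γ : Ctx} (x y : Term Γ T0) : RCA0w Γ ((lt x y).or ((x ≐ y).or (lt y x)))
  | add_lt_add {Γ : Ctx} (x y z : Term Γ T0) :
      RCA0w Γ ((lt x y).imp (lt (add x z) (add y z)))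
  | mul_lt_mul {Γ : Ctx} (x y z : Term Γ T0) :
      RCA0w Γ ((lt zero z).imp ((lt x y).imp (lt (mul x z) (mul y z))))
  | not_lt_zero {Γ : Ctx} (x : Term Γ T0) : RCA0w Γ (lt x zero).neg
  | lt_succ {Γ : Ctx} (x y : Term Γ T0) : RCA0w Γ ((lt x (add y one)).iff (le x y))
  -- the combinators: `Π x y = x` and `Σ x y z = x z (y z)`
  | combPi {Γ : Ctx} {ρ σ : FinType} (x : Term Γ ρ) (y : Term Γ σ) :
      RCA0w Γ (eqAt ρ (.const (.combPi ρ σ) ⬝ x ⬝ y) x)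
  | combSigma {Γ : Ctx} {ρ σ τ : FinType} (x : Term Γ (ρ ⇾ σ ⇾ τ)) (y : Term Γ (ρ ⇾ σ))
      (z : Term Γ ρ) :
      RCA0w Γ (eqAt τ (.const (.combSigma ρ σ τ) ⬝ x ⬝ y ⬝ z) (x ⬝ z ⬝ (y ⬝ z)))
  -- the recursor `R₀`: `R₀(f, m, 0) = m` and `R₀(f, m, n + 1) = f(R₀(f, m, n))`
  | rec_zero {Γ : Ctx} (f : Term Γ T1) (m : Term Γ T0) :
      RCA0w Γ (.const (.recursor T0) ⬝ f ⬝ m ⬝ zero ≐ m)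
  | rec_succ {Γ : Ctx} (f : Term Γ T1) (m n : Term Γ T0) :
      RCA0w Γ (.const (.recursor T0) ⬝ f ⬝ m ⬝ add n one ≐
        f ⬝ (.const (.recursor T0) ⬝ f ⬝ m ⬝ n))
  -- extensionality
  | ext {Γ : Ctx} {ρ τ : FinType} (x y : Term Γ ρ) (φ : Term Γ (ρ ⇾ τ)) :
      RCA0w Γ ((eqAt ρ x y).imp (eqAt τ (φ ⬝ x) (φ ⬝ y)))
  -- induction for quantifier-free formulas
  | ind {Γ : Ctx} (A : Formula (T0 :: Γ)) (hA : A.IsQF) :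
      RCA0w Γ ((A.inst zero).imp ((all T0 (A.imp (succInst A))).imp (all T0 A)))
  -- `QF-AC^{1,0}`
  | qfac {Γ : Ctx} {A : Formula Γ} (hA : QFAC T1 T0 Γ A) : RCA0w Γ A

/-- `RCA₀^ω + QF-AC^{2,0}`. -/
def RCA0wQFAC20 : Axioms := fun Γ A => RCA0w Γ A ∨ QFAC T2 T0 Γ A

/-! ## Sequences, Cantor space and the principles -/

section Principles

variable {Γ : Ctx}

/-- `f ∈ C`, that is `f ≤₁ 1`. -/
def inCantor (f : Term Γ T1) : Formula Γ := leAt T1 f (oneAt T1)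

/-- The number `(x + y)² + x` coding the pair `(x, y)`. -/
def pair (x y : Term Γ T0) : Term Γ T0 := add (mul (add x y) (add x y)) x

/-- `s = \overline{f}n`, the code of the finite sequence `⟨f(0), …, f(n - 1)⟩`. The empty sequence
has code `0` and extending a sequence with code `c` by the entry `a` gives the code
`pair c a + 1`; so `s = c(n)` for the function `c` with `c(0) = 0` and
`c(i + 1) = pair (c(i)) (f(i)) + 1`. -/
def isInitSeg (f : Term Γ T1) (n s : Term Γ T0) : Formula Γ :=
  .ex T1 ((v0 ⬝ zero ≐ zero).and
    ((Formula.all T0 (v1 ⬝ add v0 one ≐ add (pair (v1 ⬝ v0) (f.wk.wk ⬝ v0)) one)).and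
      (v0 ⬝ n.wk ≐ s.wk)))

/-- `\overline{f}n = \overline{g}n`. -/
def sameInitSeg (f g : Term Γ T1) (n : Term Γ T0) : Formula Γ :=
  .ex T0 ((isInitSeg f.wk n.wk v0).and (isInitSeg g.wk n.wk v0))

/-- `h(\overline{g}n) = 0`; this also expresses that `\overline{g}n` is an element of the set of
(codes of) finite sequences with characteristic function `h`, where `0` stands for membership. -/
def zeroAtInitSeg (h g : Term Γ T1) (n : Term Γ T0) : Formula Γ :=
  .ex T0 ((isInitSeg g.wk n.wk v0).and (h.wk ⬝ v0 ≐ zero))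

/-- `s` is the code of a finite binary sequence. -/
def isBinSeq (s : Term Γ T0) : Formula Γ :=
  .ex T1 ((inCantor v0).and (.ex T0 (isInitSeg v1 v0 s.wk.wk)))

/-- `t` is a binary tree: its elements are (codes of) finite binary sequences, and it is closed
under initial segments. -/
def isBinTree (t : Term Γ T1) : Formula Γ :=
  (Formula.all T0 ((t.wk ⬝ v0 ≐ zero).imp (isBinSeq v0))).and
    (.all T1 ((inCantor v0).imp (.all T0 (.all T0
      ((le v0 v1).imp ((zeroAtInitSeg t.wk.wk.wk v2 v1).imp
        (zeroAtInitSeg t.wk.wk.wk v2 v0)))))))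

/-- The set `t` is infinite, i.e. it has arbitrarily large elements. -/
def isInfinite (t : Term Γ T1) : Formula Γ :=
  .all T0 (.ex T0 ((Formula.lt v1 v0).and (t.wk.wk ⬝ v0 ≐ zero)))

/-- `f` is a path through the binary tree `t`. -/
def isPath (t f : Term Γ T1) : Formula Γ :=
  (inCantor f).and (.all T0 (zeroAtInitSeg t.wk f.wk v0))

end Principles

/-- Weak König's lemma: every infinite binary tree has a path. -/
def WKL : Sentence :=
  .all T1 ((isBinTree v0).imp ((isInfinite v0).imp (.ex T1 (isPath v1 v0))))

/-- `(∃²)`: `∃ φ² ≤₂ 1 ∀ f¹ [∃ n (f(n) = 0) ↔ φ(f) = 0]`. -/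
def Exists2 : Sentence :=
  .ex T2 ((leAt T2 v0 (oneAt T2)).and
    (.all T1 ((Formula.ex T0 (v1 ⬝ v0 ≐ zero)).iff (v1 ⬝ v0 ≐ zero))))

/-- `(S²)`: `∃ S² ≤₂ 1 ∀ f¹ [∃ g¹ ∀ n (f(\overline{g}n) = 0) ↔ S(f) = 0]`. -/
def Suslin2 : Sentence :=
  .ex T2 ((leAt T2 v0 (oneAt T2)).and
    (.all T1 ((Formula.ex T1 (.all T0 (zeroAtInitSeg v2 v1 v0))).iff (v1 ⬝ v0 ≐ zero))))

/-- `(∃³)`: `∃ E³ ≤₃ 1 ∀ Y² [∃ f¹ (Y(f) = 0) ↔ E(Y) = 0]`. -/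
def Exists3 : Sentence :=
  .ex T3 ((leAt T3 v0 (oneAt T3)).and
    (.all T2 ((Formula.ex T1 (v1 ⬝ v0 ≐ zero)).iff (v1 ⬝ v0 ≐ zero))))

/-- `(κ₀³)`: `∃ κ³ ∀ Y² [κ(Y) = 0 ↔ ∃ f ∈ C (Y(f) > 0)]`. -/
def Kappa3 : Sentence :=
  .ex T3 (.all T2
    ((v1 ⬝ v0 ≐ zero).iff (.ex T1 ((inCantor v0).and (.lt zero (v1 ⬝ v0))))))

/-- `MUC`, the intuitionistic fan functional:
`∃ Ω³ ∀ Y² ∀ f, g ∈ C (\overline{f}Ω(Y) = \overline{g}Ω(Y) → Y(f) = Y(g))`. -/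
def MUC : Sentence :=
  .ex T3 (.all T2 (.all T1 ((inCantor v0).imp (.all T1 ((inCantor v0).imp
    ((sameInitSeg v1 v0 (v3 ⬝ v2)).imp (v2 ⬝ v1 ≐ v2 ⬝ v0)))))))

end HOArith

/-! No derivation is written out. By a completeness theorem it suffices that each equivalence holds
in every extensional model of the base theory (`proves_of_forall_model`). Since the language is
countable, the negation of an unprovable sentence starts a Henkin construction. Its term structure,
divided by hereditary equality, is a model in which equality is identity, and the extensionality
axiom makes that quotient well defined.

The numbers of a model may be nonstandard, so only its axioms may be used. The combinators give
lambda abstraction, and `QF-AC^{1,0}` gives characteristic functions of quantifier-free predicates.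
With induction and the one recursor `R_0` these yield primitive recursion, bounded search and coding
of finite sequences.

Mathematically, `MUC` says that functionals are uniformly continuous on Cantor space, with a modulus
given by a functional. This refutes `(∃²)`, which is discontinuous. It gives `(κ₀³)`, because
finitely many test points decide whether `Y` is positive somewhere on `C`. It gives `WKL`, because a
functional measuring where each sequence leaves a tree is bounded.

Conversely, if `(∃²)` fails, Grilliot's trick makes every `Y` continuous at each point
(`continuous_of_not_exists2`). Suppose `Y` were not uniformly continuous on `C`. The binary
sequences above which `Y` is not constant form an infinite tree, which is a set thanks to `(κ₀³)`,
and `Y` would be discontinuous at the path that `WKL` provides (`uniformly_continuous`). Being a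
modulus is decidable by `(κ₀³)`, so `QF-AC^{2,0}` selects moduli.

The other two equivalences hold because `(κ₀³)` and `(∃²)` give `(∃³)`, which gives `(S²)`, which
gives `(∃²)`. Given `(κ₀³)`, the three negations therefore coincide. -/

namespace HOArith

/-! ## Substitution calculus -/

section Substitution

variable {Γ Δ Ξ : Ctx} {σ τ : FinType}

theorem Term.rename_eq_subst (r : Ren Γ Δ) (t : Term Γ σ) :
    t.rename r = t.subst (fun _ x => .var (r _ x)) := by
  induction t with
  | var x => rfl
  | const c => rfl
  | app t u iht ihu => simp only [Term.rename, Term.subst, iht, ihu]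

theorem Term.subst_subst (s : Subst Γ Δ) (s' : Subst Δ Ξ) (t : Term Γ σ) :
    (t.subst s).subst s' = t.subst (fun _ x => (s _ x).subst s') := by
  induction t with
  | var x => rfl
  | const c => rfl
  | app t u iht ihu => simp only [Term.subst, iht, ihu]

theorem Term.subst_var (t : Term Γ σ) : t.subst (fun _ x => .var x) = t := by
  induction t with
  | var x => rfl
  | const c => rfl
  | app t u iht ihu => simp only [Term.subst, iht, ihu]

theorem Term.wk_eq_subst (t : Term Γ σ) :
    (t.wk : Term (τ :: Γ) σ) = t.subst (fun _ x => .var x.there) :=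
  Term.rename_eq_subst _ t

theorem Term.wk_subst_lift (s : Subst Γ Δ) (t : Term Γ σ) :
    (t.wk : Term (τ :: Γ) σ).subst (s.lift τ) = (t.subst s).wk := by
  simp only [Term.wk_eq_subst, Term.subst_subst]
  congr 1
  funext ρ x
  exact Term.wk_eq_subst _

theorem Term.wk_subst_cons (s : Subst Γ Δ) (u : Term Δ τ) (t : Term Γ σ) :
    (t.wk : Term (τ :: Γ) σ).subst (Subst.cons u s) = t.subst s := by
  simp only [Term.wk_eq_subst, Term.subst_subst]
  rfl

theorem Subst.lift_comp (s : Subst Γ Δ) (s' : Subst Δ Ξ) :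
    (fun ρ x => ((s.lift τ) ρ x).subst (s'.lift τ)) =
      Subst.lift (fun _ x => (s _ x).subst s') τ := by
  funext ρ x
  cases x with
  | here => rfl
  | there x => exact Term.wk_subst_lift s' _

theorem Formula.subst_subst {Γ Δ Ξ : Ctx} (s : Subst Γ Δ) (s' : Subst Δ Ξ) (A : Formula Γ) :
    (A.subst s).subst s' = A.subst (fun _ x => (s _ x).subst s') := by
  induction A generalizing Δ Ξ with
  | falsum => rfl
  | eq t u => simp only [Formula.subst, Term.subst_subst]
  | lt t u => simp only [Formula.subst, Term.subst_subst]
  | imp A B ihA ihB => simp only [Formula.subst, ihA, ihB]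
  | all σ A ih => simp only [Formula.subst, ih, Subst.lift_comp]

theorem Subst.lift_var :
    Subst.lift (fun _ x => Term.var x : Subst Γ Γ) τ = fun _ x => Term.var x := by
  funext ρ x
  cases x <;> rfl

theorem Formula.subst_var {Γ : Ctx} (A : Formula Γ) : A.subst (fun _ x => .var x) = A := by
  induction A with
  | falsum => rfl
  | eq t u => simp only [Formula.subst, Term.subst_var]
  | lt t u => simp only [Formula.subst, Term.subst_var]
  | imp A B ihA ihB => simp only [Formula.subst, ihA, ihB]
  | all σ A ih => simp only [Formula.subst, Subst.lift_var, ih]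

theorem Ren.lift_eq (r : Ren Γ Δ) :
    Subst.lift (fun _ x => Term.var (r _ x)) τ = fun _ x => Term.var (r.lift τ _ x) := by
  funext ρ x
  cases x <;> rfl

theorem Formula.rename_eq_subst {Γ Δ : Ctx} (r : Ren Γ Δ) (A : Formula Γ) :
    A.rename r = A.subst (fun _ x => .var (r _ x)) := by
  induction A generalizing Δ with
  | falsum => rfl
  | eq t u => simp only [Formula.subst, Formula.rename, Term.rename_eq_subst]
  | lt t u => simp only [Formula.subst, Formula.rename, Term.rename_eq_subst]
  | imp A B ihA ihB => simp only [Formula.subst, Formula.rename, ihA, ihB]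
  | all σ A ih => simp only [Formula.subst, Formula.rename, ih, Ren.lift_eq]

theorem Formula.rename_subst (s : Subst Γ Δ) (r : Ren Δ Ξ) (A : Formula Γ) :
    (A.subst s).rename r = A.subst (fun _ x => (s _ x).rename r) := by
  simp only [Formula.rename_eq_subst, Formula.subst_subst, Term.rename_eq_subst]

theorem Formula.inst_subst_lift (s : Subst Γ Δ) (t : Term Δ τ) (A : Formula (τ :: Γ)) :
    (A.subst (s.lift τ)).inst t = A.subst (Subst.cons t s) := by
  rw [Formula.inst, Formula.subst_subst]
  congr 1
  funext ρ x
  cases x with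
  | here => rfl
  | there x => exact (Term.wk_subst_cons _ _ _).trans (Term.subst_var _)

theorem Formula.inst_subst (s : Subst Γ Δ) (t : Term Γ τ) (A : Formula (τ :: Γ)) :
    (A.inst t).subst s = (A.subst (s.lift τ)).inst (t.subst s) := by
  rw [Formula.inst_subst_lift, Formula.inst, Formula.subst_subst]
  congr 1
  funext ρ x
  cases x <;> rfl

theorem Formula.isQF_subst {Γ Δ : Ctx} (s : Subst Γ Δ) {A : Formula Γ} (hA : A.IsQF) :
    (A.subst s).IsQF := by
  induction A generalizing Δ with
  | falsum => trivial
  | eq t u => trivial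
  | lt t u => trivial
  | imp A B ihA ihB => exact ⟨ihA s hA.1, ihB s hA.2⟩
  | all σ A ih => exact hA.elim

theorem succInst_subst (s : Subst Γ Δ) (A : Formula (T0 :: Γ)) :
    (succInst A).subst (s.lift T0) = succInst (A.subst (s.lift T0)) := by
  simp only [succInst, Formula.subst_subst]
  congr 1
  funext ρ x
  cases x with
  | here => rfl
  | there x => exact ((Term.wk_subst_cons _ _ _).trans (Term.wk_eq_subst _).symm).symm

theorem choiceInst_subst (s : Subst Γ Δ) (A : Formula (τ :: σ :: Γ)) :
    (choiceInst A).subst ((s.lift (σ ⇾ τ)).lift σ) =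
      choiceInst (A.subst ((s.lift σ).lift τ)) := by
  simp only [choiceInst, Formula.subst_subst]
  congr 1
  funext ρ x
  cases x with
  | here => rfl
  | there x =>
    cases x with
    | here => rfl
    | there x =>
      refine Eq.symm ((Term.wk_subst_cons _ _ _).trans ((Term.wk_subst_cons _ _ _).trans ?_))
      refine Eq.trans ?_ (Term.wk_eq_subst _).symm
      refine Eq.trans ?_ (congrArg _ (Term.wk_eq_subst (s ρ x)).symm)
      rw [Term.subst_subst]
      rfl

theorem eqAt_subst {Γ Δ : Ctx} (s : Subst Γ Δ) (τ : FinType) (x y : Term Γ τ) :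
    (eqAt τ x y).subst s = eqAt τ (x.subst s) (y.subst s) := by
  induction τ generalizing Γ Δ with
  | nat => rfl
  | arr σ τ _ ih =>
    simp only [eqAt, Formula.subst, ih, Term.subst, Term.wk_subst_lift]
    rfl

/-- The axioms are closed under substitution. -/
theorem RCA0w.subst (s : Subst Γ Δ) {A : Formula Γ} (hA : RCA0w Γ A) : RCA0w Δ (A.subst s) := by
  cases hA with
  | add_assoc x y z => exact .add_assoc _ _ _
  | add_comm x y => exact .add_comm _ _
  | add_zero x => exact .add_zero _
  | mul_assoc x y z => exact .mul_assoc _ _ _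
  | mul_comm x y => exact .mul_comm _ _
  | mul_one x => exact .mul_one _
  | mul_zero x => exact .mul_zero _
  | mul_add x y z => exact .mul_add _ _ _
  | lt_irrefl x => exact .lt_irrefl _
  | lt_trans x y z => exact .lt_trans _ _ _
  | lt_total x y => exact .lt_total _ _
  | add_lt_add x y z => exact .add_lt_add _ _ _
  | mul_lt_mul x y z => exact .mul_lt_mul _ _ _
  | not_lt_zero x => exact .not_lt_zero _
  | lt_succ x y => exact .lt_succ _ _
  | combPi x y => rw [eqAt_subst]; exact .combPi _ _
  | combSigma x y z => rw [eqAt_subst]; exact .combSigma _ _ _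
  | rec_zero f m => exact .rec_zero _ _
  | rec_succ f m n => exact .rec_succ _ _ _
  | ext x y φ =>
    simp only [Formula.subst, eqAt_subst]
    exact .ext _ _ _
  | ind A hA =>
    simp only [Formula.subst, Formula.inst_subst, succInst_subst]
    exact .ind _ (Formula.isQF_subst _ hA)
  | qfac hA =>
    cases hA with
    | mk A hA =>
      refine .qfac ?_
      have := QFAC.mk (A.subst ((s.lift T1).lift T0)) (Formula.isQF_subst _ hA)
      rw [← choiceInst_subst] at this
      exact this

theorem RCA0wQFAC20.subst (s : Subst Γ Δ) {A : Formula Γ} (hA : RCA0wQFAC20 Γ A) :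
    RCA0wQFAC20 Δ (A.subst s) := by
  rcases hA with hA | hA
  · exact .inl (hA.subst s)
  · cases hA with
    | mk A hA =>
      refine .inr ?_
      have := QFAC.mk (A.subst ((s.lift T2).lift T0)) (Formula.isQF_subst _ hA)
      rw [← choiceInst_subst] at this
      exact this

end Substitution

/-! ## Countability of the language -/

section Countability

/-- Countability of types, terms and formulas is what allows the Henkin construction to treat every
formula in countably many stages. -/
def FinType.code : FinType → ℕ
  | .nat => 0
  | .arr σ τ => Nat.pair σ.code τ.code + 1

theorem FinType.code_injective : Function.Injective FinType.code := by
  intro σ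
  induction σ with
  | nat => intro τ h; cases τ <;> simp [FinType.code] at h ⊢
  | arr a b iha ihb =>
    intro τ h
    cases τ with
    | nat => simp [FinType.code] at h
    | arr c d =>
      simp only [FinType.code, Nat.add_right_cancel_iff, Nat.pair_eq_pair] at h
      rw [iha h.1, ihb h.2]

def Var.code : {Γ : Ctx} → {σ : FinType} → Var Γ σ → ℕ
  | _, _, .here => 0
  | _, _, .there x => x.code + 1

theorem Var.code_injective {Γ : Ctx} {σ : FinType} (x y : Var Γ σ) (h : x.code = y.code) :
    x = y := by
  induction x with
  | here => cases y with
    | here => rfl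
    | there y => simp [Var.code] at h
  | there x ih => cases y with
    | here => simp [Var.code] at h
    | there y => rw [ih y (by simpa [Var.code] using h)]

def Const.code : {σ : FinType} → Const σ → ℕ × FinType × FinType × FinType
  | _, .zero => (0, .nat, .nat, .nat)
  | _, .one => (1, .nat, .nat, .nat)
  | _, .add => (2, .nat, .nat, .nat)
  | _, .mul => (3, .nat, .nat, .nat)
  | _, .combPi ρ σ => (4, ρ, σ, .nat)
  | _, .combSigma ρ σ τ => (5, ρ, σ, τ)
  | _, .recursor σ => (6, σ, .nat, .nat)

theorem Const.code_injective {σ τ : FinType} (c : Const σ) (d : Const τ) (h : c.code = d.code) :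
    σ = τ ∧ HEq c d := by
  cases c <;> cases d <;> simp [Const.code] at h ⊢
  · obtain ⟨rfl, rfl⟩ := h; simp
  · obtain ⟨rfl, rfl, rfl⟩ := h; simp
  · subst h; simp

instance : Countable FinType := FinType.code_injective.countable

instance (σ : FinType) : Countable (Const σ) :=
  Function.Injective.countable (f := fun c : Const σ => c.code)
    fun c d h => eq_of_heq (Const.code_injective c d h).2

instance (Γ : Ctx) (σ : FinType) : Countable (Var Γ σ) :=
  Function.Injective.countable (f := Var.code) fun x y h => Var.code_injective x y h

/-- A code for terms, given codes for constants. -/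
noncomputable def Term.code {Γ : Ctx} : {σ : FinType} → Term Γ σ → ℕ × ℕ
  | _, .var x => (0, x.code)
  | σ, .const c => (1, (nonempty_encodable (Const σ)).some.encode c)
  | _, .app (σ := σ) t u =>
      (2, Nat.pair σ.code (Nat.pair (Nat.pair t.code.1 t.code.2) (Nat.pair u.code.1 u.code.2)))

theorem Term.code_injective {Γ : Ctx} {σ : FinType} (t u : Term Γ σ) (h : t.code = u.code) :
    t = u := by
  induction t with
  | var x =>
    cases u with
    | var y => rw [Var.code_injective x y (by simpa [Term.code] using h)]
    | const c => simp [Term.code] at h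
    | app u v => simp [Term.code] at h
  | @const σ c =>
    cases u with
    | var y => simp [Term.code] at h
    | const d =>
      simp only [Term.code, Prod.mk.injEq, true_and] at h
      rw [(nonempty_encodable (Const σ)).some.encode_injective h]
    | app u v => simp [Term.code] at h
  | app t t' ih ih' =>
    cases u with
    | var y => simp [Term.code] at h
    | const d => simp [Term.code] at h
    | app u v =>
      simp only [Term.code, Nat.pair_eq_pair, Prod.mk.injEq, true_and] at h
      obtain ⟨hσ, ⟨h1, h2⟩, h3, h4⟩ := h
      -- An application hides its argument type. The code records it, so the two argument types can
      -- be identified before the induction hypotheses apply.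
      cases FinType.code_injective hσ
      rw [ih u (Prod.ext h1 h2), ih' v (Prod.ext h3 h4)]

instance (Γ : Ctx) (σ : FinType) : Countable (Term Γ σ) :=
  Function.Injective.countable (f := Term.code) fun x y h => Term.code_injective x y h

noncomputable def Formula.code : {Γ : Ctx} → Formula Γ → ℕ × ℕ
  | _, .falsum => (0, 0)
  | Γ, .eq t u => (1, Nat.pair ((nonempty_encodable (Term Γ T0)).some.encode t)
      ((nonempty_encodable (Term Γ T0)).some.encode u))
  | Γ, .lt t u => (2, Nat.pair ((nonempty_encodable (Term Γ T0)).some.encode t)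
      ((nonempty_encodable (Term Γ T0)).some.encode u))
  | _, .imp A B => (3, Nat.pair (Nat.pair A.code.1 A.code.2) (Nat.pair B.code.1 B.code.2))
  | _, .all σ A => (4, Nat.pair σ.code (Nat.pair A.code.1 A.code.2))

theorem Formula.code_injective {Γ : Ctx} (A B : Formula Γ) (h : A.code = B.code) : A = B := by
  induction A with
  | falsum => cases B <;> simp [Formula.code] at h ⊢
  | eq t u =>
    cases B with
    | eq v w =>
      simp only [Formula.code, Nat.pair_eq_pair, Prod.mk.injEq, true_and, Encodable.encode_inj] at h
      rw [h.1, h.2]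
    | _ => simp [Formula.code] at h
  | lt t u =>
    cases B with
    | lt v w =>
      simp only [Formula.code, Nat.pair_eq_pair, Prod.mk.injEq, true_and, Encodable.encode_inj] at h
      rw [h.1, h.2]
    | _ => simp [Formula.code] at h
  | imp A A' ih ih' =>
    cases B with
    | imp B B' =>
      simp only [Formula.code, Nat.pair_eq_pair, Prod.mk.injEq, true_and] at h
      rw [ih B (Prod.ext h.1.1 h.1.2), ih' B' (Prod.ext h.2.1 h.2.2)]
    | _ => simp [Formula.code] at h
  | all σ A ih =>
    cases B with
    | all τ B =>
      simp only [Formula.code, Nat.pair_eq_pair, Prod.mk.injEq, true_and] at h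
      obtain ⟨hσ, h⟩ := h
      cases FinType.code_injective hσ
      rw [ih B (Prod.ext h.1 h.2)]
    | _ => simp [Formula.code] at h

instance (Γ : Ctx) : Countable (Formula Γ) :=
  Function.Injective.countable (f := Formula.code) fun x y h => Formula.code_injective x y h

end Countability

end HOArith

/-! ### Completeness, syntactic half: consistent extensions with witnesses. -/

namespace HOArith

open Filter

/-! ## Derivability -/

section Derivability

variable {T : Axioms} {Γ : Ctx} {H H' : List (Formula Γ)} {A B : Formula Γ}

theorem Derives.weaken {Γ : Ctx} {H H' : List (Formula Γ)} {A : Formula Γ}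
    (h : Derives T Γ H A) (hH : H ⊆ H') : Derives T Γ H' A := by
  induction h with
  | ax h => exact .ax h
  | hyp h => exact .hyp (hH h)
  | impI _ ih => exact .impI (ih (List.cons_subset_cons _ hH))
  | impE _ _ ih ih' => exact .impE (ih hH) (ih' hH)
  | byContra _ ih => exact .byContra (ih (List.cons_subset_cons _ hH))
  | allI _ ih => exact .allI (ih (List.map_subset _ hH))
  | allE t _ ih => exact .allE t (ih hH)
  | eqRefl t => exact .eqRefl t
  | eqSubst A _ _ ih ih' => exact .eqSubst A (ih hH) (ih' hH)

theorem Derives.exfalso (h : Derives T Γ H .falsum) : Derives T Γ H A :=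
  .byContra (h.weaken (List.subset_cons_self _ _))

theorem Derives.eq_symm {t u : Term Γ T0} (h : Derives T Γ H (t ≐ u)) :
    Derives T Γ H (u ≐ t) := by
  have := Derives.eqSubst (v0 ≐ t.wk) h
    (by simpa [Formula.inst, Formula.subst, Term.subst, Subst.cons, Term.wk_subst_cons,
      Term.subst_var] using Derives.eqRefl t)
  simpa [Formula.inst, Formula.subst, Term.subst, Subst.cons, Term.wk_subst_cons,
      Term.subst_var] using this

theorem Derives.eq_trans {t u v : Term Γ T0} (h : Derives T Γ H (t ≐ u))
    (h' : Derives T Γ H (u ≐ v)) : Derives T Γ H (t ≐ v) := by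
  have := Derives.eqSubst (t.wk ≐ v0) h'
    (by simpa [Formula.inst, Formula.subst, Term.subst, Subst.cons, Term.wk_subst_cons,
      Term.subst_var] using h)
  simpa [Formula.inst, Formula.subst, Term.subst, Subst.cons, Term.wk_subst_cons,
      Term.subst_var] using this

theorem Derives.lt_congr {t t' u u' : Term Γ T0} (ht : Derives T Γ H (t ≐ t'))
    (hu : Derives T Γ H (u ≐ u')) (h : Derives T Γ H (.lt t u)) :
    Derives T Γ H (.lt t' u') := by
  have h1 : Derives T Γ H (.lt t' u) := by
    have := Derives.eqSubst (.lt v0 u.wk) ht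
      (by simpa [Formula.inst, Formula.subst, Term.subst, Subst.cons, Term.wk_subst_cons,
        Term.subst_var] using h)
    simpa [Formula.inst, Formula.subst, Term.subst, Subst.cons, Term.wk_subst_cons,
        Term.subst_var] using this
  have := Derives.eqSubst (.lt t'.wk v0) hu
    (by simpa [Formula.inst, Formula.subst, Term.subst, Subst.cons, Term.wk_subst_cons,
      Term.subst_var] using h1)
  simpa [Formula.inst, Formula.subst, Term.subst, Subst.cons, Term.wk_subst_cons,
      Term.subst_var] using this

/-- The closed term of type `σ` with constant value `0`. -/
def zeroAt {Γ : Ctx} : (σ : FinType) → Term Γ σ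
  | .nat => zero
  | .arr σ τ => .const (.combPi τ σ) ⬝ zeroAt τ

/-- Every type has a closed term, so a fresh variable is harmless: a contradiction that uses it can
be generalised and then instantiated. -/
theorem consistent_map_wk (h : ¬ Derives T Γ H .falsum) (τ : FinType) :
    ¬ Derives T (τ :: Γ) (H.map Formula.wk) .falsum :=
  fun h' => h (Derives.allE (A := .falsum) (zeroAt τ) (.allI h'))

/-- One Henkin step. It adds `B` if that is consistent and `B.neg` otherwise, and always exactly one
fresh variable. That variable is the witness against a refuted universal formula, and a dummy of
type `0` in all other cases. -/
theorem exists_extension (hH : ¬ Derives T Γ H .falsum) (B : Formula Γ) :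
    ∃ (τ : FinType) (H' : List (Formula (τ :: Γ))), ¬ Derives T (τ :: Γ) H' .falsum ∧
      (∀ A ∈ H, A.wk ∈ H') ∧ (B.wk ∈ H' ∨ B.neg.wk ∈ H') ∧
      ∀ (σ : FinType) (C : Formula (σ :: Γ)), B = .all σ C → B.wk ∈ H' ∨
        ∃ v : Term (τ :: Γ) σ, (C.subst (Subst.cons v fun _ x => .var x.there)).neg ∈ H' := by
  by_cases hB : Derives T Γ (B :: H) .falsum
  · have hn : ¬ Derives T Γ (B.neg :: H) .falsum := fun h => hH (.impE (.impI hB) (.byContra h))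
    by_cases hall : ∃ (σ : FinType) (C : Formula (σ :: Γ)), B = .all σ C
    · obtain ⟨σ, C, rfl⟩ := hall
      -- If `C.neg` for the fresh variable led to a contradiction, `C` would be derivable for an
      -- arbitrary value, hence so would its generalisation, against `hn`.
      refine ⟨σ, C.neg :: (Formula.neg (.all σ C) :: H).map Formula.wk, fun h => hn ?_, ?_, ?_, ?_⟩
      · exact .impE (.hyp List.mem_cons_self) (.allI (.byContra h))
      · intro A hA
        exact List.mem_cons_of_mem _ (List.mem_map_of_mem (List.mem_cons_of_mem _ hA))
      · exact .inr (List.mem_cons_of_mem _ (List.mem_map_of_mem List.mem_cons_self))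
      · intro σ' C' h
        cases h
        refine .inr ⟨v0, ?_⟩
        have : (Subst.cons v0 fun _ x => .var x.there : Subst (σ :: Γ) (σ :: Γ)) =
            fun _ x => .var x := by
          funext ρ x
          cases x <;> rfl
        rw [this, Formula.subst_var]
        exact List.mem_cons_self
    · refine ⟨T0, (B.neg :: H).map Formula.wk, consistent_map_wk hn _, ?_, ?_, ?_⟩
      · exact fun A hA => List.mem_map_of_mem (List.mem_cons_of_mem _ hA)
      · exact .inr (List.mem_map_of_mem List.mem_cons_self)
      · exact fun σ C h => (hall ⟨σ, C, h⟩).elim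
  · refine ⟨T0, (B :: H).map Formula.wk, consistent_map_wk hB _, ?_, ?_, ?_⟩
    · exact fun A hA => List.mem_map_of_mem (List.mem_cons_of_mem _ hA)
    · exact .inl (List.mem_map_of_mem List.mem_cons_self)
    · exact fun σ C h => .inl (List.mem_map_of_mem List.mem_cons_self)

end Derivability

/-! ## Henkin chains -/

/-- An increasing chain of consistent sets of hypotheses in growing contexts which decides every
formula and has a witness for every refuted universal formula. -/
structure HenkinChain (T : Axioms) where
  ctx : ℕ → Ctx
  up : ∀ n, Ren (ctx n) (ctx (n + 1))
  hyps : ∀ n, List (Formula (ctx n))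
  consistent : ∀ n, ¬ Derives T (ctx n) (hyps n) .falsum
  mono : ∀ n, ∀ A ∈ hyps n, A.rename (up n) ∈ hyps (n + 1)
  decide : ∀ (B : ∀ n, Formula (ctx n)) (N : ℕ),
    (∀ n ≥ N, B (n + 1) = (B n).rename (up n)) →
    ∃ n ≥ N, (B (n + 1) ∈ hyps (n + 1) ∨ (B (n + 1)).neg ∈ hyps (n + 1)) ∧
      ∀ (σ : FinType) (C : Formula (σ :: ctx n)), B n = .all σ C →
        B (n + 1) ∈ hyps (n + 1) ∨ ∃ v : Term (ctx (n + 1)) σ,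
          (C.subst (Subst.cons v fun _ x => .var (up n _ x))).neg ∈ hyps (n + 1)

namespace HenkinChain

/-- A stage of the construction of a Henkin chain. -/
structure Stage (T : Axioms) where
  ctx : Ctx
  hyps : List (Formula ctx)
  consistent : ¬ Derives T ctx hyps .falsum
  todo : ℕ → ℕ → Formula ctx

variable {T : Axioms}

/-- An enumeration of the formulas over a context. -/
noncomputable def enum (Γ : Ctx) : ℕ → Formula Γ :=
  haveI : Nonempty (Formula Γ) := ⟨.falsum⟩
  (exists_surjective_nat (Formula Γ)).choose

theorem enum_surjective (Γ : Ctx) : Function.Surjective (enum Γ) :=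
  haveI : Nonempty (Formula Γ) := ⟨.falsum⟩
  (exists_surjective_nat (Formula Γ)).choose_spec

/-- The formula decided at stage `n`. -/
def Stage.task (p : Stage T) (n : ℕ) : Formula p.ctx := p.todo n.unpair.1 n.unpair.2

/-- The next stage. -/
noncomputable def Stage.next (p : Stage T) (n : ℕ) : Stage T where
  ctx := (exists_extension p.consistent (p.task n)).choose :: p.ctx
  hyps := (exists_extension p.consistent (p.task n)).choose_spec.choose
  consistent := (exists_extension p.consistent (p.task n)).choose_spec.choose_spec.1
  -- Row `m` is reset to an enumeration of the current formulas until stage `m`, where it is frozen;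
  -- afterwards it is only weakened.
  todo m k := if m ≤ n then (p.todo m k).wk else enum _ k

/-- The stages of the construction. -/
noncomputable def stage (p : Stage T) : ℕ → Stage T
  | 0 => p
  | n + 1 => (stage p n).next n

theorem todo_self (p : Stage T) (hp : ∀ k, p.todo 0 k = enum _ k) (n k : ℕ) :
    (stage p n).todo n k = enum _ k := by
  cases n with
  | zero => exact hp k
  | succ n => exact if_neg (by omega)

theorem todo_succ (p : Stage T) {m n : ℕ} (h : m ≤ n) (k : ℕ) :
    (stage p (n + 1)).todo m k = ((stage p n).todo m k).wk := if_pos h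

/-- The chain obtained from a consistent set of hypotheses. -/
noncomputable def ofStage (p : Stage T) (hp : ∀ k, p.todo 0 k = enum _ k) : HenkinChain T where
  ctx n := (stage p n).ctx
  up n := fun _ x => Var.there x
  hyps n := (stage p n).hyps
  consistent n := (stage p n).consistent
  mono n := (exists_extension (stage p n).consistent
    ((stage p n).task n)).choose_spec.choose_spec.2.1
  decide B N hB := by
    obtain ⟨k, hk⟩ := enum_surjective _ (B N)
    have key : ∀ n ≥ N, B n = (stage p n).todo N k := by
      intro n hn
      induction n, hn using Nat.le_induction with
      | base => rw [todo_self p hp, hk]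
      | succ n hn ih => rw [hB n hn, todo_succ p hn, ih]; rfl
    -- The formula listed as entry `k` of row `N` is treated at stage `Nat.pair N k`. This is not
    -- before stage `N`, so the row is already frozen by then.
    have hn : Nat.pair N k ≥ N := Nat.left_le_pair N k
    refine ⟨Nat.pair N k, hn, ?_⟩
    have hB' : B (Nat.pair N k) = (stage p (Nat.pair N k)).task (Nat.pair N k) := by
      rw [key _ hn, Stage.task, Nat.unpair_pair]
    have := (exists_extension (stage p (Nat.pair N k)).consistent
      ((stage p (Nat.pair N k)).task (Nat.pair N k))).choose_spec.choose_spec.2.2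
    rw [hB _ hn]
    refine ⟨?_, ?_⟩
    · rw [hB']; exact this.1
    · intro σ C hC
      have h2 := this.2 σ C (hB' ▸ hC)
      rw [hB']
      exact h2

/-- The substitution for sentences. -/
def _root_.HOArith.Subst.nil {Γ : Ctx} : Subst [] Γ := fun _ x => nomatch x

theorem exists_chain {A : Sentence} (h : ¬ Proves T A) :
    ∃ K : HenkinChain T, A.neg.subst Subst.nil ∈ K.hyps 0 := by
  refine ⟨ofStage ⟨[], [A.neg], fun h' => h (.byContra h'), fun _ => enum []⟩ fun _ => rfl, ?_⟩
  refine List.mem_singleton.2 (Eq.trans ?_ (Formula.subst_var _))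
  congr 1
  funext σ x
  cases x

end HenkinChain

end HOArith

/-! ### Completeness, semantic half: the term model and its extensional quotient. -/

namespace HOArith

open Filter

/-! ## Structures and satisfaction -/

/-- A structure for the language of all finite types; equality at type `0` is interpreted by a
relation. -/
structure Structure where
  D : FinType → Type
  app : ∀ {σ τ : FinType}, D (σ ⇾ τ) → D σ → D τ
  cst : ∀ {σ : FinType}, Const σ → D σ
  eq : D T0 → D T0 → Prop
  lt : D T0 → D T0 → Prop

namespace Structure

/-- Assignments of elements to the variables of a context. -/
def Env (M : Structure) (Γ : Ctx) : Type := ∀ σ : FinType, Var Γ σ → M.D σ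

variable {M : Structure} {Γ Δ : Ctx}

/-- The empty assignment. -/
def Env.nil : M.Env [] := fun _ x => nomatch x

/-- Extend an assignment by a value for the most recently bound variable. -/
def Env.cons {σ : FinType} (d : M.D σ) (ρ : M.Env Γ) : M.Env (σ :: Γ)
  | _, .here => d
  | _, .there x => ρ _ x

/-- The value of a term. -/
def eval (M : Structure) (ρ : M.Env Γ) : {σ : FinType} → Term Γ σ → M.D σ
  | _, .var x => ρ _ x
  | _, .const c => M.cst c
  | _, .app t u => M.app (M.eval ρ t) (M.eval ρ u)

/-- Satisfaction of formulas. -/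
def Sat (M : Structure) : {Γ : Ctx} → M.Env Γ → Formula Γ → Prop
  | _, _, .falsum => False
  | _, ρ, .eq t u => M.eq (M.eval ρ t) (M.eval ρ u)
  | _, ρ, .lt t u => M.lt (M.eval ρ t) (M.eval ρ u)
  | _, ρ, .imp A B => M.Sat ρ A → M.Sat ρ B
  | _, ρ, .all σ A => ∀ d : M.D σ, M.Sat (.cons d ρ) A

theorem eval_subst (s : Subst Γ Δ) (ρ : M.Env Δ) {σ : FinType} (t : Term Γ σ) :
    M.eval ρ (t.subst s) = M.eval (fun _ x => M.eval ρ (s _ x)) t := by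
  induction t with
  | var x => rfl
  | const c => rfl
  | app t u iht ihu => simp only [Term.subst, eval, iht, ihu]

theorem eval_wk (ρ : M.Env Γ) {σ τ : FinType} (d : M.D τ) (t : Term Γ σ) :
    M.eval (.cons d ρ) t.wk = M.eval ρ t := by
  rw [Term.wk_eq_subst, eval_subst]
  rfl

theorem env_lift (s : Subst Γ Δ) (ρ : M.Env Δ) {τ : FinType} (d : M.D τ) :
    (fun _ x => M.eval (.cons d ρ) (s.lift τ _ x)) =
      (Env.cons d fun _ x => M.eval ρ (s _ x) : M.Env (τ :: Γ)) := by
  funext σ x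
  cases x with
  | here => rfl
  | there x => exact eval_wk ρ d _

theorem sat_subst {Γ Δ : Ctx} (s : Subst Γ Δ) (ρ : M.Env Δ) (A : Formula Γ) :
    M.Sat ρ (A.subst s) ↔ M.Sat (fun _ x => M.eval ρ (s _ x)) A := by
  induction A generalizing Δ with
  | falsum => rfl
  | eq t u => simp only [Formula.subst, Sat, eval_subst]
  | lt t u => simp only [Formula.subst, Sat, eval_subst]
  | imp A B ihA ihB => simp only [Formula.subst, Sat, ihA, ihB]
  | all σ A ih => simp only [Formula.subst, Sat, ih, env_lift]

/-- Equality at type `τ`, defined hereditarily from equality at type `0`. -/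
def Equal (M : Structure) : (τ : FinType) → M.D τ → M.D τ → Prop
  | .nat, x, y => M.eq x y
  | .arr σ τ, x, y => ∀ z : M.D σ, M.Equal τ (M.app x z) (M.app y z)

theorem sat_eqAt {Γ : Ctx} (ρ : M.Env Γ) (τ : FinType) (x y : Term Γ τ) :
    M.Sat ρ (eqAt τ x y) ↔ M.Equal τ (M.eval ρ x) (M.eval ρ y) := by
  induction τ generalizing Γ with
  | nat => rfl
  | arr σ τ _ ih => simp only [eqAt, Sat, ih, eval, eval_wk, Equal]; rfl

/-! ### Extensional quotients -/

/-- The conditions under which equality is a congruence. -/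
structure Congruence (M : Structure) : Prop where
  refl : ∀ x, M.eq x x
  symm : ∀ {x y}, M.eq x y → M.eq y x
  trans : ∀ {x y z}, M.eq x y → M.eq y z → M.eq x z
  lt_congr : ∀ {x x' y y'}, M.eq x x' → M.eq y y' → M.lt x y → M.lt x' y'
  app_congr : ∀ {σ τ : FinType} (f : M.D (σ ⇾ τ)) {x y : M.D σ}, M.Equal σ x y →
    M.Equal τ (M.app f x) (M.app f y)

namespace Congruence

theorem equal_equivalence (h : M.Congruence) (τ : FinType) : Equivalence (M.Equal τ) := by
  induction τ with
  | nat => exact ⟨h.refl, h.symm, h.trans⟩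
  | arr σ τ _ ih =>
    exact ⟨fun f z => ih.refl _, fun hf z => ih.symm (hf z),
      fun hf hg z => ih.trans (hf z) (hg z)⟩

/-- Hereditary equality as a setoid. -/
def setoid (h : M.Congruence) (τ : FinType) : Setoid (M.D τ) := ⟨M.Equal τ, h.equal_equivalence τ⟩

/-- The quotient of a structure by hereditary equality. -/
def quotient (h : M.Congruence) : Structure where
  D τ := Quotient (h.setoid τ)
  app {_ τ} := Quotient.map₂ (sa := h.setoid _) (sb := h.setoid _) (sc := h.setoid _) M.app
    fun f _ hf _ y hx => (h.equal_equivalence τ).trans (h.app_congr f hx) (hf y)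
  cst c := Quotient.mk (h.setoid _) (M.cst c)
  eq x y := x = y
  lt := Quotient.lift₂ (s₁ := h.setoid _) (s₂ := h.setoid _) M.lt fun _ _ _ _ hx hy =>
    propext ⟨h.lt_congr hx hy, h.lt_congr (h.symm hx) (h.symm hy)⟩

/-- The projection to the quotient. -/
def proj (h : M.Congruence) {τ : FinType} (x : M.D τ) : h.quotient.D τ := Quotient.mk (h.setoid τ) x

theorem proj_surjective (h : M.Congruence) {τ : FinType} (x : h.quotient.D τ) :
    ∃ y, h.proj y = x := Quotient.exists_rep x

theorem proj_eq_proj (h : M.Congruence) {τ : FinType} (x y : M.D τ) :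
    h.proj x = h.proj y ↔ M.Equal τ x y := Quotient.eq (r := h.setoid τ)

theorem eval_proj (h : M.Congruence) (ρ : M.Env Γ) {σ : FinType} (t : Term Γ σ) :
    h.quotient.eval (fun _ x => h.proj (ρ _ x)) t = h.proj (M.eval ρ t) := by
  induction t with
  | var x => rfl
  | const c => rfl
  | app t u iht ihu => simp only [eval, iht, ihu]; rfl

theorem proj_cons (h : M.Congruence) (ρ : M.Env Γ) {σ : FinType} (d : M.D σ) :
    (Env.cons (h.proj d) fun _ x => h.proj (ρ _ x) : h.quotient.Env (σ :: Γ)) =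
      fun _ x => h.proj (Env.cons d ρ _ x) := by
  funext τ x
  cases x <;> rfl

theorem sat_proj (h : M.Congruence) {Γ : Ctx} (ρ : M.Env Γ) (A : Formula Γ) :
    h.quotient.Sat (fun _ x => h.proj (ρ _ x)) A ↔ M.Sat ρ A := by
  induction A with
  | falsum => rfl
  | eq t u => simp only [Sat, eval_proj]; exact h.proj_eq_proj _ _
  | lt t u => simp only [Sat, eval_proj]; rfl
  | imp A B ihA ihB => simp only [Sat, ihA, ihB]
  | all σ A ih =>
    simp only [Sat, ← ih, ← proj_cons]
    refine ⟨fun H d => H _, fun H d => ?_⟩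
    obtain ⟨d, rfl⟩ := h.proj_surjective d
    exact H d

end Congruence

end Structure

/-! ## The term structure of a Henkin chain -/

namespace HenkinChain

variable {T : Axioms} (K : HenkinChain T)

/-- A formula that varies with the stage is eventually derivable. -/
def Ev (B : ∀ n, Formula (K.ctx n)) : Prop :=
  ∀ᶠ n in atTop, Derives T (K.ctx n) (K.hyps n) (B n)

/-- A formula that varies with the stage is eventually constant, up to weakening. -/
def Coherent (B : ∀ n, Formula (K.ctx n)) : Prop :=
  ∀ᶠ n in atTop, B (n + 1) = (B n).rename (K.up n)

variable {K}

theorem persist {B : ∀ n, Formula (K.ctx n)} {N m : ℕ}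
    (hB : ∀ n ≥ N, B (n + 1) = (B n).rename (K.up n)) (hm : N ≤ m) (h : B m ∈ K.hyps m) :
    ∀ n ≥ m, B n ∈ K.hyps n := by
  intro n hn
  induction n, hn using Nat.le_induction with
  | base => exact h
  | succ n hn ih => rw [hB n (hm.trans hn)]; exact K.mono n _ ih

theorem persist_ev {B : ∀ n, Formula (K.ctx n)} {N m : ℕ}
    (hB : ∀ n ≥ N, B (n + 1) = (B n).rename (K.up n)) (hm : N ≤ m) (h : B m ∈ K.hyps m) :
    K.Ev B :=
  eventually_atTop.2 ⟨m, fun n hn => .hyp (persist hB hm h n hn)⟩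

theorem coherent_neg {N : ℕ} {B : ∀ n, Formula (K.ctx n)}
    (hB : ∀ n ≥ N, B (n + 1) = (B n).rename (K.up n)) :
    ∀ n ≥ N, (B (n + 1)).neg = ((B n).neg).rename (K.up n) := by
  intro n hn
  rw [hB n hn]
  rfl

/-- The chain decides the family at some stage, and hypotheses persist along the chain. -/
theorem ev_or_ev_neg {B : ∀ n, Formula (K.ctx n)} (hB : K.Coherent B) :
    K.Ev B ∨ K.Ev fun n => (B n).neg := by
  obtain ⟨N, hN⟩ := eventually_atTop.1 hB
  obtain ⟨n, hn, h | h, -⟩ := K.decide B N hN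
  · exact .inl (persist_ev hN (by omega : N ≤ n + 1) h)
  · exact .inr (persist_ev (B := fun n => (B n).neg) (coherent_neg hN) (by omega : N ≤ n + 1) h)

theorem not_ev_falsum : ¬ K.Ev fun _ => .falsum := by
  intro h
  obtain ⟨n, hn⟩ := h.exists
  exact K.consistent n hn

/-- From right to left, decidedness of `A` is needed: either `A` is eventually derivable, and then
so is `B`, or its negation is, and the implication holds vacuously. -/
theorem ev_imp {A B : ∀ n, Formula (K.ctx n)} (hA : K.Coherent A) :
    (K.Ev fun n => (A n).imp (B n)) ↔ (K.Ev A → K.Ev B) := by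
  refine ⟨fun h hA => ?_, fun h => ?_⟩
  · filter_upwards [h, hA] with n h1 h2 using .impE h1 h2
  · rcases ev_or_ev_neg hA with h1 | h1
    · filter_upwards [h h1] with n h2 using .impI (h2.weaken (List.subset_cons_self _ _))
    · filter_upwards [h1] with n h2
      exact .impI (Derives.exfalso (.impE (h2.weaken (List.subset_cons_self _ _))
        (.hyp List.mem_cons_self)))

variable (K)

/-- Terms that vary with the stage and are eventually constant, up to weakening. -/
def Elt (σ : FinType) : Type :=
  {t : ∀ n, Term (K.ctx n) σ // ∀ᶠ n in atTop, t (n + 1) = (t n).rename (K.up n)}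

/-- The term structure. -/
def toStructure : Structure where
  D := K.Elt
  app f x := ⟨fun n => f.1 n ⬝ x.1 n, by
    filter_upwards [f.2, x.2] with n hf hx
    rw [hf, hx]
    rfl⟩
  cst c := ⟨fun n => .const c, .of_forall fun n => rfl⟩
  eq x y := K.Ev fun n => x.1 n ≐ y.1 n
  lt x y := K.Ev fun n => .lt (x.1 n) (y.1 n)

variable {K}

/-- The substitution given by an assignment at a stage. -/
def sub {Γ : Ctx} (ρ : K.toStructure.Env Γ) (n : ℕ) : Subst Γ (K.ctx n) := fun _ x => (ρ _ x).1 n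

theorem eval_val {Γ : Ctx} (ρ : K.toStructure.Env Γ) {σ : FinType} (t : Term Γ σ) (n : ℕ) :
    (K.toStructure.eval ρ t).1 n = t.subst (sub ρ n) := by
  induction t with
  | var x => rfl
  | const c => rfl
  | app t u iht ihu =>
    simp only [Term.subst, ← iht, ← ihu]
    rfl

theorem sub_cons {Γ : Ctx} (ρ : K.toStructure.Env Γ) {σ : FinType} (d : K.Elt σ) (n : ℕ) :
    sub (Structure.Env.cons (M := K.toStructure) d ρ) n = Subst.cons (d.1 n) (sub ρ n) := by
  funext τ x
  cases x <;> rfl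

/-- A context is finite, so finitely many "eventually" statements can be met at once. -/
theorem sub_coherent {Γ : Ctx} (ρ : K.toStructure.Env Γ) :
    ∀ᶠ n in atTop, sub ρ (n + 1) = fun _ x => (sub ρ n _ x).rename (K.up n) := by
  induction Γ with
  | nil => exact .of_forall fun n => by funext σ x; cases x
  | cons τ Γ ih =>
    filter_upwards [ih fun _ x => ρ _ x.there, (ρ _ .here).2] with n h1 h2
    funext σ x
    cases x with
    | here => exact h2
    | there x => exact congrFun (congrFun h1 σ) x

theorem coherent_subst {Γ : Ctx} (ρ : K.toStructure.Env Γ) (A : Formula Γ) :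
    K.Coherent fun n => A.subst (sub ρ n) := by
  filter_upwards [sub_coherent ρ] with n hn
  rw [hn, Formula.rename_subst]

/-- Auxiliary sequence of terms which is `t` at stage `N`. -/
def eltSeq {σ : FinType} {N : ℕ} (t : Term (K.ctx N) σ) : ∀ n, Term (K.ctx n) σ
  | 0 => if h : N = 0 then h ▸ t else zeroAt σ
  | n + 1 => if h : N = n + 1 then h ▸ t else (eltSeq t n).rename (K.up n)

theorem eltSeq_self {σ : FinType} {N : ℕ} (t : Term (K.ctx N) σ) : eltSeq t N = t := by
  cases N <;> simp [eltSeq]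

/-- A Henkin witness appears only at some stage `N`; here it becomes an element. The values before
stage `N` are irrelevant fillers. -/
theorem exists_elt {σ : FinType} {N : ℕ} (t : Term (K.ctx N) σ) : 
    ∃ d : K.Elt σ, d.1 N = t ∧ ∀ n ≥ N, d.1 (n + 1) = (d.1 n).rename (K.up n) :=
  have h : ∀ n ≥ N, eltSeq t (n + 1) = (eltSeq t n).rename (K.up n) :=
    fun n hn => by rw [eltSeq, dif_neg (by omega)]
  ⟨⟨eltSeq t, eventually_atTop.2 ⟨N, h⟩⟩, eltSeq_self t, h⟩

/-- This is where witnesses are used. If the universal formula is not adopted, the chain contains a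
counterexample term; extended to an element, it contradicts the assumption that every instance is
eventually derivable. -/
theorem ev_all {Γ : Ctx} (ρ : K.toStructure.Env Γ) {σ : FinType} (A : Formula (σ :: Γ)) :
    (K.Ev fun n => (Formula.all σ A).subst (sub ρ n)) ↔
      ∀ d : K.Elt σ, K.Ev fun n => A.subst (Subst.cons (d.1 n) (sub ρ n)) := by
  refine ⟨fun h d => ?_, fun h => ?_⟩
  · filter_upwards [h] with n hn
    rw [← Formula.inst_subst_lift]
    exact .allE _ hn
  · obtain ⟨N, hN⟩ := eventually_atTop.1 (coherent_subst ρ (.all σ A))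
    obtain ⟨N', hN'⟩ := eventually_atTop.1 (sub_coherent ρ)
    obtain ⟨n, hn, -, hw⟩ := K.decide (fun n => (Formula.all σ A).subst (sub ρ n)) (max N N')
      fun n hn => hN n (by omega)
    rcases hw σ _ rfl with hw | ⟨v, hv⟩
    · exact persist_ev hN (by omega : N ≤ n + 1) hw
    · exfalso
      obtain ⟨d, hd, hd'⟩ := exists_elt v
      have hcoh : ∀ m ≥ n + 1, A.subst (Subst.cons (d.1 (m + 1)) (sub ρ (m + 1))) =
          (A.subst (Subst.cons (d.1 m) (sub ρ m))).rename (K.up m) := by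
        intro m hm
        rw [Formula.rename_subst, hd' m hm, hN' m (by omega)]
        congr 1
        funext τ x
        cases x <;> rfl
      have key : (A.subst ((sub ρ n).lift σ)).subst
          (Subst.cons v fun _ x => .var (K.up n _ x)) =
          A.subst (Subst.cons (d.1 (n + 1)) (sub ρ (n + 1))) := by
        rw [Formula.subst_subst, hd, hN' n (by omega)]
        congr 1
        funext τ x
        cases x with
        | here => rfl
        | there x => exact (Term.wk_subst_cons _ _ _).trans (Term.rename_eq_subst _ _).symm
      rw [key] at hv
      have hneg := persist_ev (B := fun m => (A.subst (Subst.cons (d.1 m) (sub ρ m))).neg)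
        (coherent_neg (B := fun m => A.subst (Subst.cons (d.1 m) (sub ρ m))) hcoh) le_rfl hv
      exact not_ev_falsum (((h d).and hneg).mono fun m hm => .impE hm.2 hm.1)

/-- Truth in the term structure is eventual derivability. -/
theorem sat_iff_ev {Γ : Ctx} (ρ : K.toStructure.Env Γ) (A : Formula Γ) :
    K.toStructure.Sat ρ A ↔ K.Ev fun n => A.subst (sub ρ n) := by
  induction A with
  | falsum => exact ⟨False.elim, not_ev_falsum⟩
  | eq t u => simp only [Formula.subst, ← eval_val]; rfl
  | lt t u => simp only [Formula.subst, ← eval_val]; rfl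
  | imp A B ihA ihB =>
    rw [Structure.Sat, ihA, ihB]
    exact (ev_imp (coherent_subst ρ A)).symm
  | all σ A ih =>
    rw [ev_all, Structure.Sat]
    refine forall_congr' fun d => ?_
    exact (ih _).trans (Iff.of_eq (congrArg K.Ev (funext fun n =>
      congrArg (fun s => A.subst s) (sub_cons ρ d n))))

theorem sat_of_mem (hT : ∀ {Γ Δ : Ctx} (s : Subst Γ Δ) {A : Formula Γ}, T Γ A → T Δ (A.subst s))
    {Γ : Ctx} (ρ : K.toStructure.Env Γ) {A : Formula Γ} (hA : T Γ A) :
    K.toStructure.Sat ρ A :=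
  (sat_iff_ev ρ A).2 (.of_forall fun _ => .ax (hT _ hA))

/-- Compatibility with application is the extensionality axiom, read in the term structure; the rest
comes from the equality rules. -/
theorem congruence (hT : ∀ {Γ Δ : Ctx} (s : Subst Γ Δ) {A : Formula Γ}, T Γ A → T Δ (A.subst s))
    (hext : ∀ {Γ A}, RCA0w Γ A → T Γ A) : K.toStructure.Congruence where
  refl x := .of_forall fun n => .eqRefl _
  symm h := h.mono fun n hn => hn.eq_symm
  trans h h' := (h.and h').mono fun n hn => hn.1.eq_trans hn.2
  lt_congr h h' h'' := (h.and (h'.and h'')).mono fun n hn => Derives.lt_congr hn.1 hn.2.1 hn.2.2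
  app_congr {σ τ} f x y h := by
    have := sat_of_mem (K := K) hT (Γ := [σ, σ, σ ⇾ τ]) (.cons x (.cons y (.cons f .nil)))
      (hext (RCA0w.ext v0 v1 v2))
    rw [Structure.Sat, Structure.sat_eqAt, Structure.sat_eqAt] at this
    exact this h

end HenkinChain

/-- Extensional models of `RCA₀^ω + QF-AC^{2,0}`. -/
structure Model extends Structure where
  eq_iff : ∀ x y : D T0, eq x y ↔ x = y
  ext : ∀ {σ τ : FinType} {f g : D (σ ⇾ τ)}, (∀ x, app f x = app g x) → f = g
  sat_of_mem : ∀ {Γ : Ctx} (ρ : toStructure.Env Γ) {A : Formula Γ},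
    RCA0wQFAC20 Γ A → toStructure.Sat ρ A

/-- Completeness with respect to extensional models. -/
theorem proves_of_forall_model {A : Sentence}
    (h : ∀ M : Model, M.Sat Structure.Env.nil A) : Proves RCA0wQFAC20 A := by
  by_contra hA
  obtain ⟨K, hK⟩ := HenkinChain.exists_chain hA
  have hT : ∀ {Γ Δ : Ctx} (s : Subst Γ Δ) {A : Formula Γ}, RCA0wQFAC20 Γ A →
      RCA0wQFAC20 Δ (A.subst s) := fun s _ hA => hA.subst s
  have hc : K.toStructure.Congruence := HenkinChain.congruence hT .inl
  have hlift : ∀ {Γ : Ctx} (ρ : hc.quotient.Env Γ),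
      ∃ ρ' : K.toStructure.Env Γ, ρ = fun _ x => hc.proj (ρ' _ x) := fun ρ =>
    ⟨fun _ x => (hc.proj_surjective (ρ _ x)).choose, by
      funext σ x
      exact (hc.proj_surjective (ρ _ x)).choose_spec.symm⟩
  let M : Model :=
    { hc.quotient with
      eq_iff := fun x y => Iff.rfl
      ext := by
        intro σ τ f g hfg
        obtain ⟨f, rfl⟩ := hc.proj_surjective f
        obtain ⟨g, rfl⟩ := hc.proj_surjective g
        exact (hc.proj_eq_proj f g).2 fun z => (hc.proj_eq_proj _ _).1 (hfg (hc.proj z))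
      sat_of_mem := by
        intro Γ ρ A hA
        obtain ⟨ρ, rfl⟩ := hlift ρ
        exact (hc.sat_proj ρ A).2 (HenkinChain.sat_of_mem hT ρ hA) }
  have hM : hc.quotient.Sat Structure.Env.nil A := h M
  obtain ⟨ρ, hρ⟩ := hlift (Structure.Env.nil : hc.quotient.Env [])
  rw [hρ, hc.sat_proj, HenkinChain.sat_iff_ev] at hM
  -- The negated sentence is a hypothesis at stage `0`. Having no free variables, it is unchanged by
  -- weakening up to the unique substitution, so it persists.
  have hneg : K.Ev fun n => (A.subst (HenkinChain.sub ρ n)).neg := by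
    have hsub : ∀ n, HenkinChain.sub ρ n = Subst.nil := fun n => by
      funext σ x
      cases x
    refine HenkinChain.persist_ev (B := fun n => A.neg.subst (HenkinChain.sub ρ n)) (N := 0)
      (m := 0) (fun n _ => ?_) le_rfl ?_
    · rw [Formula.rename_subst]
      congr 1
      funext σ x
      cases x
    · rw [hsub]
      exact hK
  exact HenkinChain.not_ev_falsum ((hM.and hneg).mono fun m hm => .impE hm.2 hm.1)

end HOArith

/-! ### Truth and ordered semiring arithmetic in a model. -/

namespace HOArith

open Structure

infixl:90 " ⋄ " => Structure.app _

namespace Structure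

variable {M : Structure} {Γ : Ctx}

theorem sat_neg (ρ : M.Env Γ) (A : Formula Γ) : M.Sat ρ A.neg ↔ ¬ M.Sat ρ A := Iff.rfl

theorem sat_and (ρ : M.Env Γ) (A B : Formula Γ) :
    M.Sat ρ (A.and B) ↔ M.Sat ρ A ∧ M.Sat ρ B := by
  simp only [Formula.and, sat_neg, Sat]
  tauto

theorem sat_or (ρ : M.Env Γ) (A B : Formula Γ) :
    M.Sat ρ (A.or B) ↔ M.Sat ρ A ∨ M.Sat ρ B := by
  simp only [Formula.or, sat_neg, Sat]
  tauto

theorem sat_iff (ρ : M.Env Γ) (A B : Formula Γ) :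
    M.Sat ρ (A.iff B) ↔ (M.Sat ρ A ↔ M.Sat ρ B) := by
  simp only [Formula.iff, sat_and, Sat]
  tauto

theorem sat_imp (ρ : M.Env Γ) (A B : Formula Γ) :
    M.Sat ρ (A.imp B) ↔ (M.Sat ρ A → M.Sat ρ B) := Iff.rfl

theorem sat_all (ρ : M.Env Γ) {σ : FinType} (A : Formula (σ :: Γ)) :
    M.Sat ρ (.all σ A) ↔ ∀ d, M.Sat (.cons d ρ) A := Iff.rfl

theorem sat_ex (ρ : M.Env Γ) {σ : FinType} (A : Formula (σ :: Γ)) :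
    M.Sat ρ (.ex σ A) ↔ ∃ d, M.Sat (.cons d ρ) A := by
  simp only [Formula.ex, sat_neg, sat_all, not_forall, not_not]

theorem sat_lt (ρ : M.Env Γ) (t u : Term Γ T0) :
    M.Sat ρ (.lt t u) ↔ M.lt (M.eval ρ t) (M.eval ρ u) := Iff.rfl

end Structure

namespace Model

variable {M : Model} {Γ : Ctx} {σ τ υ : FinType}

theorem sat_eq (ρ : M.Env Γ) (t u : Term Γ T0) :
    M.Sat ρ (t ≐ u) ↔ M.eval ρ t = M.eval ρ u := M.eq_iff _ _

theorem equal_iff (τ : FinType) (x y : M.D τ) : M.Equal τ x y ↔ x = y := by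
  induction τ with
  | nat => exact M.eq_iff x y
  | arr σ τ _ ih =>
    simp only [Equal, ih]
    exact ⟨M.ext, fun h _ => h ▸ rfl⟩

theorem sat_eqAt (ρ : M.Env Γ) (x y : Term Γ τ) :
    M.Sat ρ (eqAt τ x y) ↔ M.eval ρ x = M.eval ρ y := by
  rw [Structure.sat_eqAt, equal_iff]

/-! ## Arithmetic -/

instance : Zero (M.D T0) := ⟨M.cst .zero⟩
instance : One (M.D T0) := ⟨M.cst .one⟩
instance : Add (M.D T0) := ⟨fun x y => M.cst .add ⋄ x ⋄ y⟩
instance : Mul (M.D T0) := ⟨fun x y => M.cst .mul ⋄ x ⋄ y⟩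
instance : LT (M.D T0) := ⟨M.lt⟩
instance : LE (M.D T0) := ⟨fun x y => x < y ∨ x = y⟩

theorem eval_zero (ρ : M.Env Γ) : M.eval ρ zero = 0 := rfl
theorem eval_one (ρ : M.Env Γ) : M.eval ρ one = 1 := rfl
theorem eval_add (ρ : M.Env Γ) (t u : Term Γ T0) :
    M.eval ρ (add t u) = M.eval ρ t + M.eval ρ u := rfl

theorem sat_le (ρ : M.Env Γ) (t u : Term Γ T0) :
    M.Sat ρ (le t u) ↔ M.eval ρ t ≤ M.eval ρ u := by
  rw [le, sat_or, sat_eq]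
  rfl

theorem sat_base (ρ : M.Env Γ) {A : Formula Γ} (h : RCA0w Γ A) : M.Sat ρ A := M.sat_of_mem ρ (.inl h)

section BaseAxioms

variable (x y z : M.D T0)

/-- The assignment of three numbers to three variables. -/
def env3 : M.Env [T0, T0, T0] := .cons x (.cons y (.cons z .nil))

theorem add_assoc' : x + y + z = x + (y + z) :=
  (sat_eq _ _ _).1 (M.sat_base (env3 x y z) (.add_assoc v0 v1 v2))
theorem add_comm' : x + y = y + x :=
  (sat_eq _ _ _).1 (M.sat_base (env3 x y 0) (.add_comm v0 v1))
theorem add_zero' : x + 0 = x :=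
  (sat_eq _ _ _).1 (M.sat_base (env3 x 0 0) (.add_zero v0))
theorem mul_assoc' : x * y * z = x * (y * z) :=
  (sat_eq _ _ _).1 (M.sat_base (env3 x y z) (.mul_assoc v0 v1 v2))
theorem mul_comm' : x * y = y * x :=
  (sat_eq _ _ _).1 (M.sat_base (env3 x y 0) (.mul_comm v0 v1))
theorem mul_one' : x * 1 = x :=
  (sat_eq _ _ _).1 (M.sat_base (env3 x 0 0) (.mul_one v0))
theorem mul_zero' : x * 0 = 0 :=
  (sat_eq _ _ _).1 (M.sat_base (env3 x 0 0) (.mul_zero v0))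
theorem mul_add' : x * (y + z) = x * y + x * z :=
  (sat_eq _ _ _).1 (M.sat_base (env3 x y z) (.mul_add v0 v1 v2))
theorem lt_irrefl' : ¬ x < x := M.sat_base (env3 x 0 0) (.lt_irrefl v0)
theorem lt_trans' : x < y → y < z → x < z := M.sat_base (env3 x y z) (.lt_trans v0 v1 v2)
theorem lt_total' : x < y ∨ x = y ∨ y < x := by
  have := M.sat_base (env3 x y 0) (.lt_total v0 v1)
  rwa [sat_or, sat_or, sat_eq] at this
theorem add_lt_add' : x < y → x + z < y + z := M.sat_base (env3 x y z) (.add_lt_add v0 v1 v2)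
theorem mul_lt_mul' : 0 < z → x < y → x * z < y * z :=
  M.sat_base (env3 x y z) (.mul_lt_mul v0 v1 v2)
theorem not_lt_zero' : ¬ x < 0 := M.sat_base (env3 x 0 0) (.not_lt_zero v0)
theorem lt_succ_iff : x < y + 1 ↔ x ≤ y := by
  have := M.sat_base (env3 x y 0) (.lt_succ v0 v1)
  rwa [sat_iff, sat_le] at this

end BaseAxioms

instance : CommSemiring (M.D T0) where
  add_assoc := add_assoc'
  add_comm := add_comm'
  add_zero := add_zero'
  zero_add x := (add_comm' 0 x).trans (add_zero' x)
  mul_assoc := mul_assoc'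
  mul_comm := mul_comm'
  mul_one := mul_one'
  one_mul x := (mul_comm' 1 x).trans (mul_one' x)
  mul_zero := mul_zero'
  zero_mul x := (mul_comm' 0 x).trans (mul_zero' x)
  left_distrib := mul_add'
  right_distrib x y z := by rw [mul_comm', mul_add', mul_comm' z x, mul_comm' z y]
  nsmul := nsmulRec
  npow := npowRec

noncomputable instance : LinearOrder (M.D T0) where
  le_refl x := .inr rfl
  le_trans x y z h h' := by
    rcases h with h | rfl
    · rcases h' with h' | rfl
      · exact .inl (lt_trans' _ _ _ h h')
      · exact .inl h
    · exact h'
  le_antisymm x y h h' := by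
    rcases h with h | rfl
    · rcases h' with h' | rfl
      · exact (lt_irrefl' _ (lt_trans' _ _ _ h h')).elim
      · rfl
    · rfl
  lt_iff_le_not_ge x y := by
    refine ⟨fun h => ⟨.inl h, ?_⟩, ?_⟩
    · rintro (h' | rfl)
      · exact lt_irrefl' _ (lt_trans' _ _ _ h h')
      · exact lt_irrefl' _ h
    · rintro ⟨h | rfl, h'⟩
      · exact h
      · exact (h' (.inr rfl)).elim
  le_total x y := by
    rcases lt_total' x y with h | h | h
    · exact .inl (.inl h)
    · exact .inl (.inr h)
    · exact .inr (.inl h)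
  toDecidableLE := Classical.decRel _

theorem zero_le' (x : M.D T0) : 0 ≤ x := not_lt.1 (not_lt_zero' x)

theorem zero_lt_one' : (0 : M.D T0) < 1 := by
  have := (lt_succ_iff (M := M) 0 0).2 le_rfl
  rwa [zero_add] at this

instance : IsStrictOrderedRing (M.D T0) where
  add_le_add_left x y h z := by
    rcases h.lt_or_eq with h | rfl
    · exact (add_lt_add' _ _ _ h).le
    · exact le_rfl
  le_of_add_le_add_left x y z h := by
    by_contra h'
    have := add_lt_add' _ _ x (not_le.1 h')
    rw [add_comm z, add_comm y] at this
    exact absurd h (not_le.2 this)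
  exists_pair_ne := ⟨0, 1, zero_lt_one'.ne⟩
  zero_le_one := zero_lt_one'.le
  mul_lt_mul_of_pos_left x hx y z h := by
    change x * y < x * z
    rw [mul_comm x, mul_comm x]
    exact mul_lt_mul' _ _ _ hx h
  mul_lt_mul_of_pos_right x hx y z h := mul_lt_mul' _ _ _ hx h

theorem lt_one_iff' {x : M.D T0} : x < 1 ↔ x = 0 := by
  have := lt_succ_iff x (0 : M.D T0)
  rw [zero_add] at this
  exact this.trans ⟨fun h => le_antisymm h (zero_le' x), fun h => h.le⟩

theorem add_one_le_iff {x y : M.D T0} : x + 1 ≤ y ↔ x < y := by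
  rw [← not_lt, lt_succ_iff, not_le]


end Model

end HOArith

namespace HOArith
open Structure

namespace Model

variable {M : Model} {Γ : Ctx} {σ τ υ : FinType}
/-! ## Combinatory completeness -/

theorem combPi_apply (x : M.D σ) (y : M.D τ) : M.cst (.combPi σ τ) ⋄ x ⋄ y = x :=
  (sat_eqAt _ _ _).1 (M.sat_base (.cons x (.cons y .nil)) (RCA0w.combPi v0 v1))

theorem combSigma_apply (x : M.D (σ ⇾ τ ⇾ υ)) (y : M.D (σ ⇾ τ)) (z : M.D σ) :
    M.cst (.combSigma σ τ υ) ⋄ x ⋄ y ⋄ z = x ⋄ z ⋄ (y ⋄ z) :=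
  (sat_eqAt _ _ _).1 (M.sat_base (.cons x (.cons y (.cons z .nil))) (RCA0w.combSigma v0 v1 v2))

/-- Functions of an assignment that are given by an element of the model. -/
def IsRep : {Γ : Ctx} → {τ : FinType} → (M.Env Γ → M.D τ) → Prop
  | [], _, _ => True
  | σ :: Γ, τ, f => ∃ F : M.Env Γ → M.D (σ ⇾ τ), IsRep F ∧ ∀ ρ x, F ρ ⋄ x = f (.cons x ρ)

theorem isRep_const (c : M.D τ) : IsRep fun _ : M.Env Γ => c := by
  induction Γ generalizing τ with
  | nil => trivial
  | cons σ Γ ih => exact ⟨_, ih (M.cst (.combPi τ σ) ⋄ c), fun ρ x => combPi_apply c x⟩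

/-- Bracket abstraction: constants are handled by `Π`, application by `Σ`, and the last variable by
the identity `ΣΠΠ`. -/
theorem isRep_app {f : M.Env Γ → M.D (σ ⇾ τ)} {g : M.Env Γ → M.D σ} (hf : IsRep f)
    (hg : IsRep g) : IsRep fun ρ => f ρ ⋄ g ρ := by
  induction Γ generalizing σ τ with
  | nil => trivial
  | cons υ Γ ih =>
    obtain ⟨F, hF, hf⟩ := hf
    obtain ⟨G, hG, hg⟩ := hg
    refine ⟨_, ih (ih (isRep_const (M.cst (.combSigma υ σ τ))) hF) hG, fun ρ x => ?_⟩
    rw [combSigma_apply, hf, hg]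

theorem isRep_var (x : Var Γ τ) : IsRep fun ρ : M.Env Γ => ρ τ x := by
  induction x with
  | @here Γ σ =>
    refine ⟨fun _ => M.cst (.combSigma σ (σ ⇾ σ) σ) ⋄ M.cst (.combPi σ (σ ⇾ σ)) ⋄
      M.cst (.combPi σ σ), isRep_const _, fun ρ x => ?_⟩
    rw [combSigma_apply, combPi_apply]
    rfl
  | @there Γ σ τ x ih =>
    exact ⟨_, isRep_app (isRep_const (M.cst (.combPi σ τ))) ih, fun ρ y => combPi_apply _ _⟩

theorem isRep_rename {Γ Δ : Ctx} {f : M.Env Γ → M.D τ} (hf : IsRep f) (r : Ren Γ Δ) :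
    IsRep fun ρ : M.Env Δ => f fun _ x => ρ _ (r _ x) := by
  induction Γ generalizing τ with
  | nil =>
    have : (fun ρ : M.Env Δ => f fun _ x => ρ _ (r _ x)) = fun _ => f .nil := by
      funext ρ
      congr 1
      funext σ x
      cases x
    rw [this]
    exact isRep_const _
  | cons σ Γ ih =>
    obtain ⟨F, hF, hf⟩ := hf
    have : (fun ρ : M.Env Δ => f fun _ x => ρ _ (r _ x)) =
        fun ρ => F (fun _ x => ρ _ (r _ (.there x))) ⋄ ρ _ (r _ .here) := by
      funext ρ
      refine Eq.trans ?_ (hf _ _).symm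
      congr 1
      funext σ x
      cases x <;> rfl
    rw [this]
    exact isRep_app (ih hF fun _ x => r _ (.there x)) (isRep_var _)

/-- The inference class of representable functions. -/
class Rep (f : M.Env Γ → M.D τ) : Prop where
  out : IsRep f

noncomputable section

instance (σ : FinType) : Inhabited (M.D σ) := ⟨M.eval .nil (zeroAt σ)⟩

/-- The element of the model which represents a function, if there is one. -/
def lam (f : M.D σ → M.D τ) : M.D (σ ⇾ τ) :=
  open Classical in if h : ∃ F : M.D (σ ⇾ τ), ∀ x, F ⋄ x = f x then h.choose else default

/-- Extensionality makes the representing element unique, so the choice made in `lam` is immaterial.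
-/
theorem lam_eq {f : M.D σ → M.D τ} {F : M.D (σ ⇾ τ)} (h : ∀ x, F ⋄ x = f x) : lam f = F := by
  have h' : ∃ F : M.D (σ ⇾ τ), ∀ x, F ⋄ x = f x := ⟨F, h⟩
  rw [lam, dif_pos h']
  exact M.ext fun x => (h'.choose_spec x).trans (h x).symm

@[simp]
theorem lam_apply (f : M.D σ → M.D τ) [hf : Rep fun ρ : M.Env [σ] => f (ρ _ .here)] (x : M.D σ) :
    lam f ⋄ x = f x := by
  obtain ⟨F, -, hF⟩ := hf.out
  rw [lam_eq (f := f) (F := F .nil) fun x => hF _ x]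
  exact hF _ _

instance (priority := high) rep_const (c : M.D τ) : Rep fun _ : M.Env Γ => c := ⟨isRep_const c⟩

instance rep_var (x : Var Γ τ) : Rep fun ρ : M.Env Γ => ρ τ x := ⟨isRep_var x⟩

instance (priority := low) rep_rename {Δ : Ctx} (f : M.Env Γ → M.D τ) [hf : Rep f] (r : Ren Γ Δ) :
    Rep fun ρ : M.Env Δ => f fun _ x => ρ _ (r _ x) := ⟨isRep_rename hf.out r⟩

instance rep_app (f : M.Env Γ → M.D (σ ⇾ τ)) (g : M.Env Γ → M.D σ) [hf : Rep f] [hg : Rep g] :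
    Rep fun ρ => f ρ ⋄ g ρ := ⟨isRep_app hf.out hg.out⟩

/-- Abstraction with parameters: the bound variable joins the context, and the representing function
so obtained must be the abstraction itself. Nested uses of `lam` are thus found by instance search.
-/
instance rep_lam (f : M.Env Γ → M.D σ → M.D τ)
    [hf : Rep fun ρ : M.Env (σ :: Γ) => f (fun _ x => ρ _ (.there x)) (ρ _ .here)] :
    Rep fun ρ => lam fun x => f ρ x := by
  obtain ⟨F, hF, h⟩ := hf.out
  have : (fun ρ => lam fun x => f ρ x) = F := by
    funext ρ
    exact lam_eq fun x => h ρ x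
  rw [this]
  exact ⟨hF⟩

instance rep_add (f g : M.Env Γ → M.D T0) [Rep f] [Rep g] : Rep fun ρ => f ρ + g ρ :=
  inferInstanceAs (Rep fun ρ => M.cst .add ⋄ f ρ ⋄ g ρ)

instance rep_mul (f g : M.Env Γ → M.D T0) [Rep f] [Rep g] : Rep fun ρ => f ρ * g ρ :=
  inferInstanceAs (Rep fun ρ => M.cst .mul ⋄ f ρ ⋄ g ρ)

/-- The iteration of a function. -/
abbrev iter (f : M.D T1) (m n : M.D T0) : M.D T0 := M.cst (.recursor T0) ⋄ f ⋄ m ⋄ n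

@[simp]
theorem iter_zero (f : M.D T1) (m : M.D T0) : iter f m 0 = m :=
  (sat_eq _ _ _).1 (M.sat_base (.cons f (.cons m .nil)) (RCA0w.rec_zero v0 v1))

@[simp]
theorem iter_succ (f : M.D T1) (m n : M.D T0) : iter f m (n + 1) = f ⋄ iter f m n :=
  (sat_eq _ _ _).1 (M.sat_base (.cons f (.cons m (.cons n .nil))) (RCA0w.rec_succ v0 v1 v2))

@[simp]
theorem iter_one (f : M.D T1) (m : M.D T0) : iter f m 1 = f ⋄ m := by
  rw [← zero_add 1, iter_succ, iter_zero]

end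

end Model

end HOArith

namespace HOArith
open Structure

namespace Model

variable {M : Model} {Γ : Ctx} {σ τ υ : FinType}

/-! ## Choice and induction -/

theorem sat_choiceInst (A : Formula (T0 :: σ :: Γ)) (ρ : M.Env Γ) (x : M.D σ) (Y : M.D (σ ⇾ T0)) :
    M.Sat (.cons x (.cons Y ρ)) (choiceInst A) ↔ M.Sat (.cons (Y ⋄ x) (.cons x ρ)) A := by
  rw [choiceInst, sat_subst]
  refine Iff.of_eq (congrArg (fun e => M.Sat e A) ?_)
  funext τ z
  cases z with
  | here => rfl
  | there z => cases z <;> rfl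

/-- The types `σ` for which `QF-AC^{σ,0}` is available. -/
class Choice (σ : FinType) : Prop where
  out : ∀ {Γ : Ctx} {A : Formula Γ}, QFAC σ T0 Γ A → RCA0wQFAC20 Γ A

instance : Choice T1 := ⟨fun h => .inl (.qfac h)⟩
instance : Choice T2 := ⟨.inr⟩

theorem choice_sat [h : Choice σ] (A : Formula (T0 :: σ :: Γ)) (hA : A.IsQF) (ρ : M.Env Γ)
    (hex : ∀ x : M.D σ, ∃ y : M.D T0, M.Sat (.cons y (.cons x ρ)) A) :
    ∃ Y : M.D (σ ⇾ T0), ∀ x, M.Sat (.cons (Y ⋄ x) (.cons x ρ)) A := by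
  have := M.sat_of_mem ρ (h.out (.mk A hA))
  rw [sat_imp, sat_all, sat_ex] at this
  simp only [sat_ex, sat_all, sat_choiceInst] at this
  exact this hex

/-- The function with values `a` at `0` and `b` at `1`. -/
abbrev two (a b : M.D T0) : M.D T1 := M.cst (.recursor T0) ⋄ (M.cst (.combPi T0 T0) ⋄ b) ⋄ a

@[simp] theorem two_zero (a b : M.D T0) : two a b ⋄ 0 = a := iter_zero _ _
@[simp] theorem two_one (a b : M.D T0) : two a b ⋄ 1 = b :=
  (iter_one _ _).trans (combPi_apply _ _)

theorem zero_ne_one' : (0 : M.D T0) ≠ 1 := zero_lt_one'.ne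

/-! ## Decidable predicates -/

/-- The inference class of predicates with a characteristic function. -/
class Dec (P : M.Env Γ → Prop) : Prop where
  out : ∃ χ : M.Env Γ → M.D T0, Rep χ ∧ ∀ ρ, (P ρ → χ ρ = 0) ∧ (¬ P ρ → χ ρ = 1)

/-- `QF-AC^{1,0}` chooses `0` or `1` according to the truth of `φ`. The number variable of `φ` is
only the slot for the chosen value, so `φ` must not depend on it. Numbers to be compared are packed
into the one function argument by `two`. -/
theorem exists_char (φ : Formula [T0, T1]) (hφ : φ.IsQF)
    (h : ∀ (f : M.D T1) (y z : M.D T0), M.Sat (.cons y (.cons f .nil)) φ ↔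
      M.Sat (.cons z (.cons f .nil)) φ) :
    ∃ Y : M.D T2, ∀ f, (M.Sat (.cons 0 (.cons f .nil)) φ → Y ⋄ f = 0) ∧
      (¬ M.Sat (.cons 0 (.cons f .nil)) φ → Y ⋄ f = 1) := by
  obtain ⟨Y, hY⟩ := M.choice_sat (σ := T1)
    ((φ.imp (v0 ≐ zero)).and (φ.neg.imp (v0 ≐ one)))
    ⟨⟨⟨hφ, trivial⟩, ⟨⟨hφ, trivial⟩, trivial⟩, trivial⟩, trivial⟩ .nil (fun f => by
      simp only [sat_and, sat_imp, sat_neg, sat_eq]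
      by_cases hf : M.Sat (.cons 0 (.cons f .nil)) φ
      · exact ⟨0, fun _ => rfl, fun h' => (h' hf).elim⟩
      · exact ⟨1, fun h' => (hf ((h _ _ _).1 h')).elim, fun _ => rfl⟩)
  refine ⟨Y, fun f => ?_⟩
  have := hY f
  simp only [sat_and, sat_imp, sat_neg, sat_eq] at this
  exact ⟨fun hf => this.1 ((h _ _ _).1 hf), fun hf => this.2 fun h' => hf ((h _ _ _).1 h')⟩

instance dec_eq (f g : M.Env Γ → M.D T0) [Rep f] [Rep g] : Dec fun ρ => f ρ = g ρ := by
  obtain ⟨Y, hY⟩ := M.exists_char ((v1 ⬝ zero) ≐ (v1 ⬝ one)) trivial (fun f y z => Iff.rfl)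
  refine ⟨fun ρ => Y ⋄ two (f ρ) (g ρ), inferInstance, fun ρ => ?_⟩
  have h : M.eval (.cons 0 (.cons (two (f ρ) (g ρ)) .nil)) ((v1 : Term [T0, T1] T1) ⬝ zero) = f ρ := two_zero (f ρ) (g ρ)
  have h' : M.eval (.cons 0 (.cons (two (f ρ) (g ρ)) .nil)) ((v1 : Term [T0, T1] T1) ⬝ one) = g ρ := two_one (f ρ) (g ρ)
  have := hY (two (f ρ) (g ρ))
  rwa [sat_eq, h, h'] at this

instance dec_lt (f g : M.Env Γ → M.D T0) [Rep f] [Rep g] : Dec fun ρ => f ρ < g ρ := by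
  obtain ⟨Y, hY⟩ := M.exists_char (.lt (v1 ⬝ zero) (v1 ⬝ one)) trivial (fun f y z => Iff.rfl)
  refine ⟨fun ρ => Y ⋄ two (f ρ) (g ρ), inferInstance, fun ρ => ?_⟩
  have h : M.eval (.cons 0 (.cons (two (f ρ) (g ρ)) .nil)) ((v1 : Term [T0, T1] T1) ⬝ zero) = f ρ := two_zero (f ρ) (g ρ)
  have h' : M.eval (.cons 0 (.cons (two (f ρ) (g ρ)) .nil)) ((v1 : Term [T0, T1] T1) ⬝ one) = g ρ := two_one (f ρ) (g ρ)
  have := hY (two (f ρ) (g ρ))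
  rwa [sat_lt, h, h'] at this

theorem Dec.congr {P Q : M.Env Γ → Prop} (hP : Dec P) (h : ∀ ρ, P ρ ↔ Q ρ) : Dec Q := by
  rwa [show Q = P from funext fun ρ => propext (h ρ).symm]

instance (priority := high) dec_const (p : Prop) : Dec fun _ : M.Env Γ => p := by
  by_cases hp : p
  · exact ⟨fun _ => 0, inferInstance, fun _ => ⟨fun _ => rfl, fun h => (h hp).elim⟩⟩
  · exact ⟨fun _ => 1, inferInstance, fun _ => ⟨fun h => (hp h).elim, fun _ => rfl⟩⟩

instance rep_ite (P : M.Env Γ → Prop) (f g : M.Env Γ → M.D T0) [hP : Dec P] [Rep f] [Rep g]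
    (inst : ∀ ρ, Decidable (P ρ)) : Rep fun ρ => if P ρ then f ρ else g ρ := by
  obtain ⟨χ, hχ, h⟩ := hP.out
  have : (fun ρ => if P ρ then f ρ else g ρ) = fun ρ => two (f ρ) (g ρ) ⋄ χ ρ := by
    funext ρ
    split_ifs with hP
    · rw [(h ρ).1 hP, two_zero]
    · rw [(h ρ).2 hP, two_one]
  rw [this]
  infer_instance

instance (priority := low) dec_rename {Δ : Ctx} (P : M.Env Γ → Prop) [hP : Dec P] (r : Ren Γ Δ) :
    Dec fun ρ : M.Env Δ => P fun _ x => ρ _ (r _ x) := by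
  obtain ⟨χ, _, h⟩ := hP.out
  exact ⟨_, rep_rename χ r, fun ρ => h _⟩

open Classical in
theorem dec_iff_rep {P : M.Env Γ → Prop} :
    Dec P ↔ Rep fun ρ => if P ρ then (0 : M.D T0) else 1 :=
  ⟨fun _ => inferInstance, fun h => ⟨_, h, fun _ => ⟨fun h => if_pos h, fun h => if_neg h⟩⟩⟩

open Classical in
instance dec_imp (P Q : M.Env Γ → Prop) [Dec P] [Dec Q] : Dec fun ρ => P ρ → Q ρ := by
  have : Rep fun ρ => if P ρ then (if Q ρ then (0 : M.D T0) else 1) else 0 := inferInstance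
  refine dec_iff_rep.2 (cast (congrArg _ ?_) this)
  funext ρ
  by_cases hP : P ρ <;> by_cases hQ : Q ρ <;> simp [hP, hQ]

instance dec_not (P : M.Env Γ → Prop) [Dec P] : Dec fun ρ => ¬ P ρ :=
  inferInstanceAs (Dec fun ρ => P ρ → False)

instance dec_and (P Q : M.Env Γ → Prop) [Dec P] [Dec Q] : Dec fun ρ => P ρ ∧ Q ρ :=
  Dec.congr (P := fun ρ => ¬ (P ρ → ¬ Q ρ)) inferInstance fun ρ => by tauto

instance dec_or (P Q : M.Env Γ → Prop) [Dec P] [Dec Q] : Dec fun ρ => P ρ ∨ Q ρ :=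
  Dec.congr (P := fun ρ => ¬ P ρ → Q ρ) inferInstance fun ρ => by tauto

instance dec_le (f g : M.Env Γ → M.D T0) [Rep f] [Rep g] : Dec fun ρ => f ρ ≤ g ρ :=
  inferInstanceAs (Dec fun ρ => f ρ < g ρ ∨ f ρ = g ρ)

theorem exists_char₁ (P : M.D σ → Prop) [hP : Dec fun ρ : M.Env [σ] => P (ρ _ .here)] :
    ∃ χ : M.D (σ ⇾ T0), ∀ x, χ ⋄ x = 0 ↔ P x := by
  obtain ⟨χ, ⟨⟨F, -, hF⟩⟩, hχ⟩ := hP.out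
  refine ⟨F .nil, fun x => ?_⟩
  have h : (P x → χ (.cons x .nil) = 0) ∧ (¬ P x → χ (.cons x .nil) = 1) := hχ (.cons x .nil)
  rw [hF]
  exact ⟨fun h0 => by_contra fun hx => zero_ne_one' (h0.symm.trans (h.2 hx)), h.1⟩

theorem exists_char₂ (P : M.D σ → M.D τ → Prop)
    [hP : Dec fun ρ : M.Env [τ, σ] => P (ρ _ (.there .here)) (ρ _ .here)] :
    ∃ χ : M.D (σ ⇾ τ ⇾ T0), ∀ x y, χ ⋄ x ⋄ y = 0 ↔ P x y := by
  obtain ⟨χ, ⟨⟨F, ⟨G, -, hG⟩, hF⟩⟩, hχ⟩ := hP.out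
  refine ⟨G .nil, fun x y => ?_⟩
  have h : (P x y → χ (.cons y (.cons x .nil)) = 0) ∧ (¬ P x y → χ (.cons y (.cons x .nil)) = 1) :=
    hχ (.cons y (.cons x .nil))
  rw [hG, hF]
  exact ⟨fun h0 => by_contra fun hx => zero_ne_one' (h0.symm.trans (h.2 hx)), h.1⟩

/-- Induction for decidable predicates. -/
theorem induction {P : M.D T0 → Prop} [hP : Dec fun ρ : M.Env [T0] => P (ρ _ .here)]
    (h0 : P 0) (hs : ∀ n, P n → P (n + 1)) (n : M.D T0) : P n := by
  obtain ⟨χ, hχ⟩ := exists_char₁ P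
  have := M.sat_base (.cons χ .nil) (.ind (v1 ⬝ v0 ≐ zero) trivial)
  rw [sat_imp, sat_imp, sat_all, sat_all, Formula.inst, sat_subst] at this
  simp only [sat_imp, succInst, sat_subst] at this
  have h0' : χ ⋄ 0 = 0 := (hχ 0).2 h0
  have hs' : ∀ n, χ ⋄ n = 0 → χ ⋄ (n + 1) = 0 := fun n hn => (hχ _).2 (hs n ((hχ n).1 hn))
  exact (hχ n).1 ((sat_eq _ _ _).1 (this ((sat_eq _ _ _).2 h0')
    (fun n hn => (sat_eq _ _ _).2 (hs' n ((sat_eq _ _ _).1 hn))) n))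

/-- The axiom of choice for decidable predicates. -/
theorem choice [Choice σ] {P : M.D σ → M.D T0 → Prop}
    [hP : Dec fun ρ : M.Env [T0, σ] => P (ρ _ (.there .here)) (ρ _ .here)]
    (hex : ∀ x, ∃ y, P x y) : ∃ Y : M.D (σ ⇾ T0), ∀ x, P x (Y ⋄ x) := by
  obtain ⟨χ, hχ⟩ := exists_char₂ P
  have hqf : Formula.IsQF (Γ := [T0, σ, σ ⇾ T0 ⇾ T0]) (v2 ⬝ v1 ⬝ v0 ≐ zero) := trivial
  obtain ⟨Y, hY⟩ := M.choice_sat (σ := σ) _ hqf (.cons χ .nil)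
    fun x => (hex x).imp fun y hy => (sat_eq _ _ _).2 ((hχ x y).2 hy)
  exact ⟨Y, fun x => (hχ x _).1 ((sat_eq _ _ _).1 (hY x))⟩

/-- Choice over numbers follows from choice over functions: a number is replaced by a constant
function and read off at `0`. -/
theorem choice_zero {P : M.D T0 → M.D T0 → Prop}
    [hP : Dec fun ρ : M.Env [T0, T0] => P (ρ _ (.there .here)) (ρ _ .here)]
    (hex : ∀ x, ∃ y, P x y) : ∃ Y : M.D T1, ∀ x, P x (Y ⋄ x) := by
  obtain ⟨χ, hχ⟩ := exists_char₂ P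
  obtain ⟨Y, hY⟩ := choice (σ := T1) (P := fun f y => χ ⋄ (f ⋄ 0) ⋄ y = 0) fun f =>
    (hex (f ⋄ 0)).imp fun y => (hχ _ y).2
  refine ⟨lam fun x => Y ⋄ (M.cst (.combPi T0 T0) ⋄ x), fun x => ?_⟩
  have := (hχ _ _).1 (hY (M.cst (.combPi T0 T0) ⋄ x))
  rw [combPi_apply] at this
  rwa [lam_apply]

end Model

end HOArith

/-! ### Primitive recursion, bounded search and sequence coding in a model. -/

namespace HOArith
open Structure

namespace Model

variable {M : Model} {Γ : Ctx} {σ τ υ : FinType}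

noncomputable section

/-! ## Subtraction and pairing -/

/-- Differences are not postulated. If none existed, induction would give `a + z < b` for every `z`,
which fails at `z = b`. -/
theorem exists_add_eq {a b : M.D T0} (h : a ≤ b) : ∃ z, b = a + z := by
  by_contra! hne
  have : ∀ z, a + z < b := fun z => by
    refine induction (P := fun z => a + z < b) ?_ (fun z hz => ?_) z
    · exact lt_of_le_of_ne (by rwa [add_zero]) (hne 0).symm
    · rw [← add_one_le_iff, add_assoc] at hz
      exact lt_of_le_of_ne hz (hne _).symm
  exact absurd (this b) (not_lt.2 (le_add_of_nonneg_left (zero_le' a)))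

instance : CanonicallyOrderedAdd (M.D T0) where
  exists_add_of_le := exists_add_eq
  le_self_add _ b := le_add_of_nonneg_right (zero_le' b)
  le_add_self _ b := le_add_of_nonneg_left (zero_le' b)

instance : Sub (M.D T0) :=
  ⟨fun a b => open Classical in if h : b ≤ a then (exists_add_eq h).choose else 0⟩

theorem sub_spec {a b : M.D T0} (h : b ≤ a) : a = b + (a - b) := by
  have : a - b = (exists_add_eq h).choose := dif_pos h
  rw [this]
  exact (exists_add_eq h).choose_spec

theorem sub_of_lt {a b : M.D T0} (h : a < b) : a - b = 0 := dif_neg (not_le.2 h)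

instance : OrderedSub (M.D T0) where
  tsub_le_iff_right a b c := by
    rcases le_or_gt b a with h | h
    · conv_rhs => rw [sub_spec h, add_comm]
      exact (add_le_add_iff_right b).symm
    · rw [sub_of_lt h]
      exact ⟨fun _ => h.le.trans le_add_self, fun _ => zero_le' c⟩

instance rep_sub (f g : M.Env Γ → M.D T0) [Rep f] [Rep g] : Rep fun ρ => f ρ - g ρ := by
  obtain ⟨Y, hY⟩ := M.choice (σ := T1)
    (P := fun f z => f ⋄ 0 = f ⋄ 1 + z ∨ (f ⋄ 0 < f ⋄ 1 ∧ z = 0)) fun f => by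
      rcases le_or_gt (f ⋄ 1) (f ⋄ 0) with h | h
      · exact (exists_add_eq h).imp fun z hz => .inl hz
      · exact ⟨0, .inr ⟨h, rfl⟩⟩
  have : (fun ρ => f ρ - g ρ) = fun ρ => Y ⋄ two (f ρ) (g ρ) := by
    funext ρ
    have := hY (two (f ρ) (g ρ))
    rw [two_zero, two_one] at this
    rcases this with h | ⟨h, h'⟩
    · conv_lhs => rw [h, add_tsub_cancel_left]
    · rw [h', sub_of_lt h]
  rw [this]
  infer_instance

/-- The pairing function. -/
def pr (x y : M.D T0) : M.D T0 := (x + y) * (x + y) + x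

theorem sqrt_unique {n s t : M.D T0} (hs : s * s ≤ n) (ht : n < (t + 1) * (t + 1)) : s ≤ t := by
  by_contra h
  rw [not_le, ← add_one_le_iff] at h
  exact absurd (mul_le_mul' h h) (not_le.2 (hs.trans_lt ht))

theorem exists_sqrt (n : M.D T0) : ∃ s, s * s ≤ n ∧ n < (s + 1) * (s + 1) := by
  by_contra! h
  have : ∀ s, s * s ≤ n := fun s => by
    refine induction (P := fun s => s * s ≤ n) ?_ (fun s hs => h s hs) s
    rw [mul_zero]
    exact zero_le' n
  have h1 := this (n + 1)
  have h2 : n + 1 ≤ (n + 1) * (n + 1) := by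
    calc n + 1 = (n + 1) * 1 := (mul_one _).symm
      _ ≤ (n + 1) * (n + 1) := mul_le_mul' le_rfl le_add_self
  exact absurd (h2.trans h1) (not_le.2 ((lt_succ_iff n n).2 le_rfl))

theorem exists_unpair (M : Model) :
    ∃ l r : M.D T1, ∀ x y, l ⋄ pr x y = x ∧ r ⋄ pr x y = y := by
  obtain ⟨S, hS⟩ := M.choice_zero exists_sqrt
  refine ⟨lam fun n => n - S ⋄ n * S ⋄ n, lam fun n => S ⋄ n - (n - S ⋄ n * S ⋄ n),
    fun x y => ?_⟩
  -- The code lies between the squares of `x + y` and `x + y + 1`, so its integer square root is `x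
  -- + y`.
  have h : S ⋄ pr x y = x + y := by
    refine le_antisymm (sqrt_unique (hS _).1 ?_) (sqrt_unique ?_ (hS _).2)
    · have : (x + y + 1) * (x + y + 1) = (x + y) * (x + y) + x + (x + y + y + 1) := by ring
      rw [this, ← add_assoc, lt_succ_iff]
      exact le_self_add
    · exact le_self_add
  simp only [lam_apply, h]
  have h' : pr x y - (x + y) * (x + y) = x := add_tsub_cancel_left _ _
  rw [h', add_tsub_cancel_left]
  exact ⟨rfl, rfl⟩

/-- The first projection for the pairing function. -/
def fst : M.D T1 := M.exists_unpair.choose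
/-- The second projection for the pairing function. -/
def snd : M.D T1 := M.exists_unpair.choose_spec.choose

@[simp] theorem fst_pr (x y : M.D T0) : fst ⋄ pr x y = x :=
  (M.exists_unpair.choose_spec.choose_spec x y).1
@[simp] theorem snd_pr (x y : M.D T0) : snd ⋄ pr x y = y :=
  (M.exists_unpair.choose_spec.choose_spec x y).2

theorem le_pr (x y : M.D T0) : x ≤ pr x y := le_add_self

theorem pr_le_pr {x y z w : M.D T0} (h : x ≤ z) (h' : y ≤ w) : pr x y ≤ pr z w :=
  add_le_add (mul_le_mul' (add_le_add h h') (add_le_add h h')) h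

instance rep_pr (f g : M.Env Γ → M.D T0) [Rep f] [Rep g] : Rep fun ρ => pr (f ρ) (g ρ) :=
  inferInstanceAs (Rep fun ρ => (f ρ + g ρ) * (f ρ + g ρ) + f ρ)

/-! ## Primitive recursion and bounded search -/

/-- The step function for primitive recursion by iteration. -/
def precStep (h : M.D (T0 ⇾ T0 ⇾ T0)) : M.D T1 :=
  lam fun s => pr (fst ⋄ s + 1) (h ⋄ (fst ⋄ s) ⋄ (snd ⋄ s))

/-- Primitive recursion. -/
def prec (h : M.D (T0 ⇾ T0 ⇾ T0)) (a n : M.D T0) : M.D T0 :=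
  snd ⋄ iter (precStep h) (pr 0 a) n

instance rep_prec (h : M.Env Γ → M.D (T0 ⇾ T0 ⇾ T0)) (a n : M.Env Γ → M.D T0) [Rep h] [Rep a]
    [Rep n] : Rep fun ρ => prec (h ρ) (a ρ) (n ρ) :=
  inferInstanceAs (Rep fun ρ => snd ⋄ iter
    (lam fun s => pr (fst ⋄ s + 1) (h ρ ⋄ (fst ⋄ s) ⋄ (snd ⋄ s))) (pr 0 (a ρ)) (n ρ))

theorem prec_zero (h : M.D (T0 ⇾ T0 ⇾ T0)) (a : M.D T0) : prec h a 0 = a := by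
  simp [prec]

theorem prec_succ (h : M.D (T0 ⇾ T0 ⇾ T0)) (a n : M.D T0) :
    prec h a (n + 1) = h ⋄ n ⋄ prec h a n := by
  -- Only iteration of a unary function is available; the first component of the state serves as the
  -- step counter.
  have key : fst ⋄ iter (precStep h) (pr 0 a) n = n := by
    refine induction (P := fun n => fst ⋄ iter (precStep h) (pr 0 a) n = n) ?_ (fun n hn => ?_) n
    · simp
    · rw [iter_succ, precStep, lam_apply, fst_pr]
      exact congrArg (· + 1) hn
  rw [prec, iter_succ]
  conv_lhs => rw [precStep, lam_apply, snd_pr]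
  rw [← precStep, key]
  rfl

/-- The least `i < n` with `h(i) = 0`, if there is one, and `n` otherwise. -/
def search (h : M.D T1) (n : M.D T0) : M.D T0 :=
  prec (lam fun i => lam fun s => if s < i then s else if h ⋄ i = 0 then i else i + 1) 0 n

instance rep_search (h : M.Env Γ → M.D T1) (n : M.Env Γ → M.D T0) [Rep h] [Rep n] :
    Rep fun ρ => search (h ρ) (n ρ) :=
  inferInstanceAs (Rep fun ρ => prec
    (lam fun i => lam fun s => if s < i then s else if h ρ ⋄ i = 0 then i else i + 1) 0 (n ρ))

theorem search_zero (h : M.D T1) : search h 0 = 0 := prec_zero _ _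

/-- A state below the stage is a zero already found and is kept; a state equal to the stage means
that none has been found. -/
theorem search_succ (h : M.D T1) (n : M.D T0) : search h (n + 1) =
    if search h n < n then search h n else if h ⋄ n = 0 then n else n + 1 := by
  rw [search, prec_succ, lam_apply, lam_apply]
  rfl

theorem search_le (h : M.D T1) (n : M.D T0) : search h n ≤ n := by
  refine induction (P := fun n => search h n ≤ n) ?_ (fun n hn => ?_) n
  · rw [search_zero]
  · rw [search_succ]
    split_ifs with h1 h2
    · exact h1.le.trans le_self_add
    · exact le_self_add
    · exact le_rfl

theorem apply_search {h : M.D T1} {n : M.D T0} (hn : search h n < n) : h ⋄ search h n = 0 := by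
  revert hn
  refine induction (P := fun n => search h n < n → h ⋄ search h n = 0) ?_ (fun n ih => ?_) n
  · exact fun h0 => (not_lt_zero' _ h0).elim
  · rw [search_succ]
    split_ifs with h1 h2
    · exact fun _ => ih h1
    · exact fun _ => h2
    · exact fun h3 => (lt_irrefl _ h3).elim

theorem apply_ne_of_lt_search {h : M.D T1} {n j : M.D T0} (hj : j < search h n) : h ⋄ j ≠ 0 := by
  revert hj
  refine induction (P := fun n => j < search h n → h ⋄ j ≠ 0) ?_ (fun n ih => ?_) n
  · rw [search_zero]
    exact fun h0 => (not_lt_zero' _ h0).elim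
  · have hle := search_le h n
    rw [search_succ]
    split_ifs with h1 h2
    · exact ih
    · rwa [← le_antisymm hle (not_lt.1 h1)]
    · intro h3
      rw [lt_succ_iff] at h3
      rcases h3.lt_or_eq with h3 | rfl
      · exact ih (h3.trans_le (not_lt.1 h1))
      · exact h2

theorem search_lt_iff (h : M.D T1) (n : M.D T0) : search h n < n ↔ ∃ i < n, h ⋄ i = 0 := by
  refine ⟨fun hn => ⟨_, hn, apply_search hn⟩, fun ⟨i, hi, h0⟩ => ?_⟩
  by_contra hn
  exact apply_ne_of_lt_search (hi.trans_le (not_lt.1 hn)) h0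

theorem lam_apply_env (f : M.Env Γ → M.D σ → M.D τ)
    [hf : Rep fun ρ : M.Env (σ :: Γ) => f (fun _ x => ρ _ (.there x)) (ρ _ .here)]
    (ρ : M.Env Γ) (x : M.D σ) : lam (f ρ) ⋄ x = f ρ x := by
  obtain ⟨F, hF, h⟩ := hf.out
  rw [lam_eq (f := f ρ) (F := F ρ) fun x => h ρ x]
  exact h ρ x

open Classical in
-- Bounded search keeps decidability under bounded number quantifiers, which makes induction and
-- choice applicable to such predicates.
instance dec_exists_lt (P : M.Env Γ → M.D T0 → Prop) (b : M.Env Γ → M.D T0) [Rep b]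
    [Dec fun ρ : M.Env (T0 :: Γ) => P (fun _ x => ρ _ (.there x)) (ρ _ .here)] :
    Dec fun ρ => ∃ i, i < b ρ ∧ P ρ i := by
  refine Dec.congr (P := fun ρ => search (lam fun i => if P ρ i then (0 : M.D T0) else 1) (b ρ)
    < b ρ) inferInstance fun ρ => ?_
  rw [search_lt_iff]
  refine exists_congr fun i => and_congr_right fun _ => ?_
  rw [lam_apply_env (fun ρ i => if P ρ i then (0 : M.D T0) else 1) ρ]
  split_ifs with h
  · exact ⟨fun _ => h, fun _ => rfl⟩
  · exact ⟨fun h' => (zero_ne_one' h'.symm).elim, fun h' => (h h').elim⟩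

instance dec_exists_le (P : M.Env Γ → M.D T0 → Prop) (b : M.Env Γ → M.D T0) [Rep b]
    [Dec fun ρ : M.Env (T0 :: Γ) => P (fun _ x => ρ _ (.there x)) (ρ _ .here)] :
    Dec fun ρ => ∃ i, i ≤ b ρ ∧ P ρ i :=
  Dec.congr (P := fun ρ => ∃ i, i < b ρ + 1 ∧ P ρ i) inferInstance fun ρ => by
    simp only [lt_succ_iff]

/-! ## Codes of finite sequences -/

/-- The code of `⟨f(0), …, f(n - 1)⟩`. -/
def seg (f : M.D T1) (n : M.D T0) : M.D T0 := prec (lam fun i => lam fun s => pr s (f ⋄ i) + 1) 0 n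

instance rep_seg (f : M.Env Γ → M.D T1) (n : M.Env Γ → M.D T0) [Rep f] [Rep n] :
    Rep fun ρ => seg (f ρ) (n ρ) :=
  inferInstanceAs (Rep fun ρ => prec
    (lam fun i => lam fun s => pr s (f ρ ⋄ i) + 1) 0 (n ρ))

@[simp] theorem seg_zero (f : M.D T1) : seg f 0 = 0 := prec_zero _ _

theorem seg_succ (f : M.D T1) (n : M.D T0) : seg f (n + 1) = pr (seg f n) (f ⋄ n) + 1 := by
  rw [seg, prec_succ, lam_apply, lam_apply]
  rfl

theorem eq_seg {c f : M.D T1} (h0 : c ⋄ 0 = 0) (hs : ∀ n, c ⋄ (n + 1) = pr (c ⋄ n) (f ⋄ n) + 1)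
    (n : M.D T0) : c ⋄ n = seg f n := by
  refine induction (P := fun n => c ⋄ n = seg f n) ?_ (fun n hn => ?_) n
  · rw [h0, seg_zero]
  · rw [hs, seg_succ, hn]

theorem seg_congr {f g : M.D T1} {n : M.D T0} (h : ∀ i < n, f ⋄ i = g ⋄ i) :
    seg f n = seg g n := by
  have : ∀ k, k ≤ n → seg f k = seg g k := fun k => by
    refine induction (P := fun k => k ≤ n → seg f k = seg g k) ?_ (fun k ih hk => ?_) k
    · simp
    · rw [add_one_le_iff] at hk
      rw [seg_succ, seg_succ, ih hk.le, h k hk]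
  exact this n le_rfl

theorem exists_succ_of_ne_zero {n : M.D T0} (h : n ≠ 0) : ∃ m, n = m + 1 := by
  have : 1 ≤ n := by
    rw [← not_lt, lt_one_iff']
    exact h
  obtain ⟨m, hm⟩ := exists_add_eq this
  exact ⟨m, hm.trans (add_comm _ _)⟩

theorem add_one_ne_zero' (n : M.D T0) : n + 1 ≠ 0 :=
  (zero_lt_one'.trans_le le_add_self).ne'

/-- Deletion of the last entry of a sequence. -/
def init : M.D T1 := lam fun s => fst ⋄ (s - 1)

theorem init_seg (f : M.D T1) (n : M.D T0) : init ⋄ seg f n = seg f (n - 1) := by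
  rw [init, lam_apply]
  by_cases h : n = 0
  · subst h
    -- The empty sequence has code `0`, which is also the pair of zeros. With truncated subtraction,
    -- deletion fixes it.
    have h0 : pr (0 : M.D T0) 0 = 0 := by simp [pr]
    rw [zero_tsub, seg_zero, zero_tsub, ← h0, fst_pr, h0]
  · obtain ⟨m, rfl⟩ := exists_succ_of_ne_zero h
    rw [seg_succ, add_tsub_cancel_right, fst_pr, add_tsub_cancel_right]

theorem iter_init_seg (f : M.D T1) (n k : M.D T0) : iter init (seg f n) k = seg f (n - k) := by
  refine induction (P := fun k => iter init (seg f n) k = seg f (n - k)) ?_ (fun k hk => ?_) k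
  · rw [iter_zero, tsub_zero]
  · rw [iter_succ, hk, init_seg, tsub_tsub]

/-- The sequence with code `s` and length `n`. -/
def entries (n s : M.D T0) : M.D T1 := lam fun i => snd ⋄ (iter init s (n - (i + 1)) - 1)

instance rep_entries (n s : M.Env Γ → M.D T0) [Rep n] [Rep s] :
    Rep fun ρ => entries (n ρ) (s ρ) :=
  inferInstanceAs (Rep fun ρ => lam fun i => snd ⋄ (iter init (s ρ) (n ρ - (i + 1)) - 1))

/-- Deleting the last `n - (i + 1)` entries leaves a sequence whose last entry is the one sought. -/
theorem entries_seg (f : M.D T1) {n i : M.D T0} (h : i < n) : entries n (seg f n) ⋄ i = f ⋄ i := by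
  rw [entries, lam_apply, iter_init_seg, tsub_tsub_cancel_of_le (add_one_le_iff.2 h), seg_succ,
    add_tsub_cancel_right, snd_pr]

theorem seg_eq_zero {f : M.D T1} {n : M.D T0} (h : seg f n = 0) : n = 0 := by
  by_contra hn
  obtain ⟨m, rfl⟩ := exists_succ_of_ne_zero hn
  rw [seg_succ] at h
  exact add_one_ne_zero' _ h

/-- Deleting as many entries as the shorter sequence has empties both, so nothing is left of the
longer one. -/
theorem length_eq_of_seg_eq {f g : M.D T1} {n m : M.D T0} (h : seg f n = seg g m) : n = m := by
  wlog hnm : n ≤ m generalizing f g n m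
  · exact (this h.symm (le_of_not_ge hnm)).symm
  have h1 := iter_init_seg f n n
  rw [h, iter_init_seg, tsub_self, seg_zero] at h1
  exact le_antisymm hnm (tsub_eq_zero_iff_le.1 (seg_eq_zero h1))

theorem seg_eq_iff {f g : M.D T1} {n : M.D T0} :
    seg f n = seg g n ↔ ∀ i < n, f ⋄ i = g ⋄ i :=
  ⟨fun h i hi => by rw [← entries_seg f hi, h, entries_seg g hi], seg_congr⟩

theorem le_seg (f : M.D T1) (n : M.D T0) : n ≤ seg f n := by
  refine induction (P := fun n => n ≤ seg f n) (zero_le' _) (fun n hn => ?_) n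
  rw [seg_succ]
  exact add_le_add_left (hn.trans (le_pr _ _)) 1

theorem seg_le_seg {f g : M.D T1} (h : ∀ i, f ⋄ i ≤ g ⋄ i) (n : M.D T0) : seg f n ≤ seg g n := by
  refine induction (P := fun n => seg f n ≤ seg g n) ?_ (fun n hn => ?_) n
  · simp
  · rw [seg_succ, seg_succ]
    exact add_le_add_left (pr_le_pr hn (h n)) 1

theorem seg_mono (f : M.D T1) {n m : M.D T0} (h : n ≤ m) : seg f n ≤ seg f m := by
  obtain ⟨k, rfl⟩ := exists_add_eq h
  refine induction (P := fun k => seg f n ≤ seg f (n + k)) ?_ (fun k hk => ?_) k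
  · rw [add_zero]
  · rw [← add_assoc, seg_succ]
    exact hk.trans ((le_pr _ _).trans le_self_add)

end

end Model

end HOArith

/-! ### Continuity, compactness and quantifiers over functions in a model. -/

namespace HOArith
open Structure

namespace Model

variable {M : Model} {Γ : Ctx} {σ τ υ : FinType}

noncomputable section

/-! ## The principles in a model -/

/-- Membership in Cantor space. -/
def InC (f : M.D T1) : Prop := ∀ i, f ⋄ i ≤ 1

/-- `(∃²)`. -/
def HasExists2 (M : Model) : Prop :=
  ∃ φ : M.D T2, (∀ f, φ ⋄ f ≤ 1) ∧ ∀ f : M.D T1, (∃ n, f ⋄ n = 0) ↔ φ ⋄ f = 0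

/-- `(S²)`. -/
def HasSuslin2 (M : Model) : Prop :=
  ∃ S : M.D T2, (∀ f, S ⋄ f ≤ 1) ∧
    ∀ f : M.D T1, (∃ g : M.D T1, ∀ n, f ⋄ seg g n = 0) ↔ S ⋄ f = 0

/-- `(∃³)`. -/
def HasExists3 (M : Model) : Prop :=
  ∃ E : M.D T3, (∀ Y, E ⋄ Y ≤ 1) ∧ ∀ Y : M.D T2, (∃ f, Y ⋄ f = 0) ↔ E ⋄ Y = 0

/-- `(κ₀³)`. -/
def HasKappa3 (M : Model) : Prop :=
  ∃ κ : M.D T3, ∀ Y : M.D T2, κ ⋄ Y = 0 ↔ ∃ f, InC f ∧ 0 < Y ⋄ f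

/-- `MUC`. -/
def HasMUC (M : Model) : Prop :=
  ∃ Ω : M.D T3, ∀ (Y : M.D T2) (f : M.D T1), InC f → ∀ g : M.D T1, InC g →
    seg f (Ω ⋄ Y) = seg g (Ω ⋄ Y) → Y ⋄ f = Y ⋄ g

/-- Binary trees. -/
def IsTree (t : M.D T1) : Prop :=
  (∀ s, t ⋄ s = 0 → ∃ f : M.D T1, InC f ∧ ∃ n, s = seg f n) ∧
    ∀ g : M.D T1, InC g → ∀ n m, m ≤ n → t ⋄ seg g n = 0 → t ⋄ seg g m = 0

/-- `WKL`. -/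
def HasWKL (M : Model) : Prop :=
  ∀ t : M.D T1, IsTree t → (∀ b, ∃ s, b < s ∧ t ⋄ s = 0) →
    ∃ f : M.D T1, InC f ∧ ∀ n, t ⋄ seg f n = 0

/-! ## Cantor space -/

theorem ite_le_one {p : Prop} [Decidable p] : (if p then (0 : M.D T0) else 1) ≤ 1 := by
  split_ifs
  · exact zero_le' _
  · exact le_rfl

theorem le_one_iff {x : M.D T0} : x ≤ 1 ↔ x = 0 ∨ x = 1 := by
  rw [le_iff_lt_or_eq, lt_one_iff']

/-- Replace the nonzero values of a function by `1`. -/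
def cut (f : M.D T1) : M.D T1 := lam fun i => if f ⋄ i = 0 then 0 else 1

instance rep_cut (f : M.Env Γ → M.D T1) [Rep f] : Rep fun ρ => cut (f ρ) :=
  inferInstanceAs (Rep fun ρ => lam fun i => if f ρ ⋄ i = 0 then 0 else 1)

theorem inC_cut (f : M.D T1) : InC (cut f) := fun i => by
  rw [cut, lam_apply]
  exact ite_le_one

theorem cut_apply {f : M.D T1} {i : M.D T0} (h : f ⋄ i ≤ 1) : cut f ⋄ i = f ⋄ i := by
  rw [cut, lam_apply]
  rcases le_one_iff.1 h with h | h
  · rw [if_pos h, h]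
  · rw [h, if_neg zero_ne_one'.symm]

theorem cut_eq {f : M.D T1} (h : InC f) : cut f = f := M.ext fun i => cut_apply (h i)

/-- An element of Cantor space which extends the binary sequence with length `n` and code `s`. -/
def extend (n s : M.D T0) : M.D T1 := cut (entries n s)

instance rep_extend (n s : M.Env Γ → M.D T0) [Rep n] [Rep s] : Rep fun ρ => extend (n ρ) (s ρ) :=
  inferInstanceAs (Rep fun ρ => cut (entries (n ρ) (s ρ)))

theorem inC_extend (n s : M.D T0) : InC (extend n s) := inC_cut _

theorem extend_seg {f : M.D T1} (hf : InC f) {n i : M.D T0} (h : i < n) :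
    extend n (seg f n) ⋄ i = f ⋄ i := by
  have := entries_seg f h
  rw [extend, cut_apply (this.trans_le (hf i)), this]

theorem seg_extend {f : M.D T1} (hf : InC f) (n : M.D T0) :
    seg (extend n (seg f n)) n = seg f n := seg_congr fun _ hi => extend_seg hf hi

/-- The sequence with constant value `1`. -/
def ones : M.D T1 := lam fun _ => 1

theorem ones_apply (i : M.D T0) : ones ⋄ i = 1 := lam_apply _ _

/-- Quantification over binary sequences of a given length thereby becomes a bounded number
quantifier. -/
theorem seg_le_seg_ones {f : M.D T1} (hf : InC f) (n : M.D T0) : seg f n ≤ seg ones n :=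
  seg_le_seg (fun i => (hf i).trans (ones_apply i).ge) n

theorem apply_le_seg (h : M.D T1) {i n : M.D T0} (hi : i < n) : h ⋄ i ≤ seg h n := by
  refine le_trans ?_ (seg_mono h (add_one_le_iff.2 hi))
  rw [seg_succ]
  by_cases h0 : h ⋄ i = 0
  · rw [h0]
    exact zero_le' _
  · have h1 : 1 ≤ h ⋄ i := by
      rw [← not_lt, lt_one_iff']
      exact h0
    have h2 : h ⋄ i ≤ seg h i + h ⋄ i := le_add_self
    calc h ⋄ i = h ⋄ i * 1 := (mul_one _).symm
      _ ≤ (seg h i + h ⋄ i) * (seg h i + h ⋄ i) := mul_le_mul' h2 (h1.trans h2)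
      _ ≤ pr (seg h i) (h ⋄ i) := le_self_add
      _ ≤ _ := le_self_add

/-! ## Discontinuous functionals -/

theorem hasExists2_of_dec (P : M.D T1 → Prop) [Dec fun ρ : M.Env [T1] => P (ρ _ .here)]
    (h : ∀ f : M.D T1, (∃ n, f ⋄ n = 0) ↔ P f) : M.HasExists2 := by
  classical
  refine ⟨lam fun f => if P f then 0 else 1, fun f => ?_, fun f => ?_⟩
  · rw [lam_apply]
    exact ite_le_one
  · rw [h, lam_apply]
    split_ifs with hf
    · exact ⟨fun _ => rfl, fun _ => hf⟩
    · exact ⟨fun h' => (hf h').elim, fun h' => (zero_ne_one' h'.symm).elim⟩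

theorem search_eq_self {h : M.D T1} {n : M.D T0} (hn : ∀ i < n, h ⋄ i ≠ 0) : search h n = n :=
  le_antisymm (search_le h n) <| not_lt.1 fun hlt => hn _ hlt (apply_search hlt)

theorem search_eq {h : M.D T1} {j n : M.D T0} (hj : j < n) (h0 : h ⋄ j = 0)
    (hne : ∀ i < j, h ⋄ i ≠ 0) : search h n = j := by
  refine le_antisymm (not_lt.1 fun hlt => apply_ne_of_lt_search hlt h0) (not_lt.1 fun hlt => ?_)
  exact hne _ hlt (apply_search (hlt.trans hj))

/-- Grilliot's trick: a functional which is discontinuous along a sequence yields `(∃²)`. -/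
theorem hasExists2_of_discontinuous (Y : M.D T2) (G : M.D (T0 ⇾ T1)) (g : M.D T1)
    (hG : ∀ n i, i < n → G ⋄ n ⋄ i = g ⋄ i) (hY : ∀ n, Y ⋄ (G ⋄ n) ≠ Y ⋄ g) : M.HasExists2 := by
  refine hasExists2_of_dec
    -- The diagonal function equals `g` when `h` has no zero, since the search then returns `i + 1`
    -- and `G ⋄ (i + 1)` agrees with `g` at `i`. If `j` is the least zero, it equals `G ⋄ j`.
    -- Comparing its value under `Y` with that of `g` therefore decides whether `h` has a zero.
    (fun h => Y ⋄ (lam fun i => G ⋄ search h (i + 1) ⋄ i) ≠ Y ⋄ g) fun h => ?_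
  by_cases hz : ∃ n, h ⋄ n = 0
  · refine iff_of_true hz ?_
    obtain ⟨n, hn⟩ := hz
    obtain ⟨j, hj0, hj⟩ : ∃ j, h ⋄ j = 0 ∧ ∀ i < j, h ⋄ i ≠ 0 :=
      ⟨search h (n + 1), apply_search ((search_lt_iff _ _).2 ⟨n, (lt_succ_iff _ _).2 le_rfl, hn⟩),
        fun i hi => apply_ne_of_lt_search hi⟩
    have : (lam fun i => G ⋄ search h (i + 1) ⋄ i) = G ⋄ j := M.ext fun i => by
      rw [lam_apply]
      rcases le_or_gt j i with hji | hij
      · rw [search_eq ((lt_succ_iff _ _).2 hji) hj0 hj]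
      · rw [search_eq_self fun k hk => hj k (((lt_succ_iff _ _).1 hk).trans_lt hij),
          hG _ _ ((lt_succ_iff _ _).2 le_rfl), hG _ _ hij]
    rw [this]
    exact hY j
  · refine iff_of_false hz (not_not.2 ?_)
    push Not at hz
    congr 1
    refine M.ext fun i => ?_
    rw [lam_apply, search_eq_self fun k _ => hz k, hG _ _ ((lt_succ_iff _ _).2 le_rfl)]

/-- Choice yields numbers, not functions, so points must be replaced by ones named by finite codes.
If `Y` separated `g` from all these approximations, Grilliot's trick would apply to them. -/
theorem exists_extend_seg_eq (hE : ¬ M.HasExists2) (Y : M.D T2) {g : M.D T1} (hg : InC g)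
    (n : M.D T0) : ∃ m, n ≤ m ∧ Y ⋄ extend m (seg g m) = Y ⋄ g := by
  by_contra! h
  refine hE (hasExists2_of_discontinuous Y (lam fun k => extend (n + k) (seg g (n + k))) g
    (fun k i hi => ?_) fun k => ?_)
  · rw [lam_apply]
    exact extend_seg hg (hi.trans_le le_add_self)
  · rw [lam_apply]
    exact h _ le_self_add

/-- At a discontinuity, coded counterexamples exist arbitrarily close to `f`; choice over numbers
turns them into a sequence for Grilliot's trick. -/
theorem continuous_of_not_exists2 (hE : ¬ M.HasExists2) (Y : M.D T2) (f : M.D T1) :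
    ∃ n, ∀ g : M.D T1, InC g → seg g n = seg f n → Y ⋄ g = Y ⋄ f := by
  by_contra! h
  have h1 : ∀ n, ∃ c, seg (extend (fst ⋄ c) (snd ⋄ c)) n = seg f n ∧
      Y ⋄ extend (fst ⋄ c) (snd ⋄ c) ≠ Y ⋄ f := fun n => by
    obtain ⟨g, hg, hgf, hne⟩ := h n
    obtain ⟨m, hnm, hm⟩ := exists_extend_seg_eq hE Y hg n
    refine ⟨pr m (seg g m), ?_⟩
    rw [fst_pr, snd_pr, hm, ← hgf]
    exact ⟨seg_congr fun i hi => extend_seg hg (hi.trans_le hnm), hne⟩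
  obtain ⟨C, hC⟩ := choice_zero h1
  refine hE (hasExists2_of_discontinuous Y
    (lam fun n => extend (fst ⋄ (C ⋄ n)) (snd ⋄ (C ⋄ n))) f (fun n i hi => ?_) fun n => ?_)
  · rw [lam_apply]
    exact seg_eq_iff.1 (hC n).1 i hi
  · rw [lam_apply]
    exact (hC n).2

/-! ## Consequences of `MUC` -/

theorem HasMUC.not_exists2 (h : M.HasMUC) : ¬ M.HasExists2 := by
  rintro ⟨φ, -, hφ⟩
  obtain ⟨Ω, hΩ⟩ := h
  -- This function agrees with `ones` as far as the modulus looks and then vanishes, so only one of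
  -- the two has a zero.
  have hg : InC (lam fun i => if i < Ω ⋄ φ then (1 : M.D T0) else 0) := fun i => by
    rw [lam_apply]
    split_ifs
    · exact le_rfl
    · exact zero_le' _
  have := hΩ φ ones (fun i => (ones_apply i).le) _ hg (seg_congr fun i hi => by
    rw [lam_apply, if_pos hi, ones_apply])
  have h0 := (hφ (lam fun i => if i < Ω ⋄ φ then (1 : M.D T0) else 0)).1
    ⟨Ω ⋄ φ, by rw [lam_apply, if_neg (lt_irrefl _)]⟩
  obtain ⟨n, hn⟩ := (hφ ones).2 (this.trans h0)
  rw [ones_apply] at hn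
  exact zero_ne_one' hn.symm

theorem HasMUC.kappa3 (h : M.HasMUC) : M.HasKappa3 := by
  classical
  obtain ⟨Ω, hΩ⟩ := h
  refine ⟨lam fun Y => if ∃ s, s ≤ seg ones (Ω ⋄ Y) ∧ 0 < Y ⋄ extend (Ω ⋄ Y) s then 0 else 1,
    fun Y => ?_⟩
  rw [lam_apply]
  split_ifs with hs
  · obtain ⟨s, -, hs⟩ := hs
    exact iff_of_true rfl ⟨_, inC_extend _ _, hs⟩
  · refine iff_of_false zero_ne_one'.symm ?_
    rintro ⟨f, hf, hY⟩
    refine hs ⟨seg f (Ω ⋄ Y), seg_le_seg_ones hf _, ?_⟩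
    rwa [hΩ Y _ (inC_extend _ _) f hf (seg_extend hf _)]

/-- Up to the modulus there are boundedly many test points, and the code of the sequence of values
at them exceeds each value. -/
theorem HasMUC.exists_bound (h : M.HasMUC) (Y : M.D T2) : ∃ b, ∀ f, InC f → Y ⋄ f ≤ b := by
  obtain ⟨Ω, hΩ⟩ := h
  refine ⟨seg (lam fun s => Y ⋄ extend (Ω ⋄ Y) s) (seg ones (Ω ⋄ Y) + 1), fun f hf => ?_⟩
  have := apply_le_seg (lam fun s => Y ⋄ extend (Ω ⋄ Y) s)
    ((lt_succ_iff _ _).2 (seg_le_seg_ones hf (Ω ⋄ Y)))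
  rwa [lam_apply, hΩ Y _ (inC_extend _ _) f hf (seg_extend hf _)] at this

theorem HasMUC.wkl (h : M.HasMUC) : M.HasWKL := by
  intro t ht hinf
  by_contra! hpath
  -- `Y` gives a level at which each binary sequence is outside the tree; `cut` makes this
  -- meaningful for all functions.
  obtain ⟨Y, hY⟩ := choice (σ := T1) (P := fun f n => t ⋄ seg (cut f) n ≠ 0)
    fun f => hpath _ (inC_cut f)
  obtain ⟨b, hb⟩ := h.exists_bound Y
  -- Infinity of a tree speaks of large codes. A code beyond all binary sequences of length at most
  -- `b` has length at least `b`.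
  obtain ⟨s, hs, hts⟩ := hinf (seg ones b)
  obtain ⟨f, hf, n, rfl⟩ := ht.1 s hts
  have hbn : b ≤ n := by
    by_contra hnb
    exact absurd ((seg_le_seg_ones hf n).trans (seg_mono _ (not_le.1 hnb).le)) (not_le.2 hs)
  have := hY f
  rw [cut_eq hf] at this
  exact this (ht.2 f hf n _ ((hb f hf).trans hbn) hts)

/-! ## The fan functional -/

/-- The first component of a pair of functions. -/
def left (h : M.D T1) : M.D T1 := lam fun i => h ⋄ pr i 0
/-- The second component of a pair of functions. -/
def right (h : M.D T1) : M.D T1 := lam fun i => h ⋄ pr i 1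

instance rep_left (h : M.Env Γ → M.D T1) [Rep h] : Rep fun ρ => left (h ρ) :=
  inferInstanceAs (Rep fun ρ => lam fun i => h ρ ⋄ pr i 0)
instance rep_right (h : M.Env Γ → M.D T1) [Rep h] : Rep fun ρ => right (h ρ) :=
  inferInstanceAs (Rep fun ρ => lam fun i => h ρ ⋄ pr i 1)

theorem inC_left {h : M.D T1} (hh : InC h) : InC (left h) := fun i => by
  rw [left, lam_apply]
  exact hh _
theorem inC_right {h : M.D T1} (hh : InC h) : InC (right h) := fun i => by
  rw [right, lam_apply]
  exact hh _

/-- `(κ₀³)` handles one quantifier over `C`; joining functions lets it handle two. -/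
theorem exists_join {f g : M.D T1} (hf : InC f) (hg : InC g) :
    ∃ h : M.D T1, InC h ∧ left h = f ∧ right h = g := by
  refine ⟨lam fun n => if snd ⋄ n = 0 then f ⋄ (fst ⋄ n) else g ⋄ (fst ⋄ n), fun i => ?_, ?_, ?_⟩
  · rw [lam_apply]
    split_ifs
    · exact hf _
    · exact hg _
  · refine M.ext fun i => ?_
    rw [left, lam_apply, lam_apply, snd_pr, fst_pr, if_pos rfl]
  · refine M.ext fun i => ?_
    rw [right, lam_apply, lam_apply, snd_pr, fst_pr, if_neg zero_ne_one'.symm]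

theorem kappa_iff {κ : M.D T3} (hκ : ∀ Y : M.D T2, κ ⋄ Y = 0 ↔ ∃ f, InC f ∧ 0 < Y ⋄ f)
    (Q : M.D T1 → Prop) [∀ h, Decidable (Q h)] [Dec fun ρ : M.Env [T1] => Q (ρ _ .here)] :
    κ ⋄ (lam fun h => if Q h then (1 : M.D T0) else 0) = 0 ↔ ∃ h, InC h ∧ Q h := by
  rw [hκ]
  refine exists_congr fun h => and_congr_right fun _ => ?_
  rw [lam_apply]
  split_ifs with hQ
  · exact iff_of_true zero_lt_one' hQ
  · exact iff_of_false (lt_irrefl _) hQ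

theorem exists_pair_iff (Q : M.D T1 → M.D T1 → Prop) :
    (∃ h, InC h ∧ Q (left h) (right h)) ↔ ∃ f g, InC f ∧ InC g ∧ Q f g := by
  constructor
  · rintro ⟨h, hh, hQ⟩
    exact ⟨_, _, inC_left hh, inC_right hh, hQ⟩
  · rintro ⟨f, g, hf, hg, hQ⟩
    obtain ⟨h, hh, rfl, rfl⟩ := exists_join hf hg
    exact ⟨h, hh, hQ⟩

theorem uniformly_continuous (hκ : M.HasKappa3) (hW : M.HasWKL) (hE : ¬ M.HasExists2)
    (Y : M.D T2) : ∃ n, ∀ f g : M.D T1, InC f → InC g → seg f n = seg g n → Y ⋄ f = Y ⋄ g := by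
  classical
  obtain ⟨κ, hκ⟩ := hκ
  by_contra! hne
  -- The tree of sequences above which `Y` takes two values. The bound `n ≤ s` on the length costs
  -- nothing by `le_seg` and makes the condition decidable, so that `κ` applies.
  obtain ⟨t, ht⟩ : ∃ t : M.D T1, ∀ s, t ⋄ s = 0 ↔ ∃ f g : M.D T1, InC f ∧ InC g ∧
      (∃ n, n ≤ s ∧ seg f n = s ∧ seg g n = s) ∧ Y ⋄ f ≠ Y ⋄ g := by
    refine ⟨lam fun s => if κ ⋄ (lam fun h => if (∃ n, n ≤ s ∧ seg (left h) n = s ∧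
      seg (right h) n = s) ∧ Y ⋄ left h ≠ Y ⋄ right h then 1 else 0) = 0 then 0 else 1,
      fun s => ?_⟩
    rw [lam_apply, ← exists_pair_iff (fun f g => (∃ n, n ≤ s ∧ seg f n = s ∧ seg g n = s) ∧
      Y ⋄ f ≠ Y ⋄ g), ← kappa_iff hκ]
    split_ifs with h
    · exact iff_of_true rfl h
    · exact iff_of_false zero_ne_one'.symm h
  have htree : IsTree t := by
    refine ⟨fun s hs => ?_, fun p _ n m hmn hn => ?_⟩
    · obtain ⟨f, g, hf, -, ⟨n, -, hn, -⟩, -⟩ := (ht s).1 hs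
      exact ⟨f, hf, n, hn.symm⟩
    · obtain ⟨f, g, hf, hg, ⟨n', -, h1, h2⟩, hY⟩ := (ht _).1 hn
      obtain rfl := length_eq_of_seg_eq h1
      refine (ht _).2 ⟨f, g, hf, hg, ⟨m, le_seg _ _, ?_, ?_⟩, hY⟩
      · exact seg_congr fun i hi => seg_eq_iff.1 h1 i (hi.trans_le hmn)
      · exact seg_congr fun i hi => seg_eq_iff.1 h2 i (hi.trans_le hmn)
  obtain ⟨p, -, hp⟩ := hW t htree fun b => by
    obtain ⟨f, g, hf, hg, hfg, hY⟩ := hne (b + 1)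
    exact ⟨seg f (b + 1), add_one_le_iff.1 (le_seg f (b + 1)),
      (ht _).2 ⟨f, g, hf, hg, ⟨_, le_seg _ _, rfl, hfg.symm⟩, hY⟩⟩
  -- Near the path `Y` is constant, yet the node of length `n` has two extensions with different
  -- values.
  obtain ⟨n, hn⟩ := continuous_of_not_exists2 hE Y p
  obtain ⟨f, g, hf, hg, ⟨m, -, h1, h2⟩, hY⟩ := (ht _).1 (hp n)
  obtain rfl := length_eq_of_seg_eq h1
  exact hY ((hn f hf h1).trans (hn g hg h2).symm)

theorem hasMUC_of_kappa3 (hκ : M.HasKappa3) (hW : M.HasWKL) (hE : ¬ M.HasExists2) :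
    M.HasMUC := by
  classical
  have huc := uniformly_continuous hκ hW hE
  obtain ⟨κ, hκ⟩ := hκ
  -- The modulus property quantifies over two functions; rewritten as an equation for `κ`, it
  -- becomes a legitimate matrix for `QF-AC^{2,0}`.
  have key : ∀ (Y : M.D T2) (n : M.D T0), ¬ κ ⋄ (lam fun h => if seg (left h) n = seg (right h) n ∧
      Y ⋄ left h ≠ Y ⋄ right h then 1 else 0) = 0 ↔
      ∀ f g : M.D T1, InC f → InC g → seg f n = seg g n → Y ⋄ f = Y ⋄ g := fun Y n => by
    rw [kappa_iff hκ, exists_pair_iff (fun f g => seg f n = seg g n ∧ Y ⋄ f ≠ Y ⋄ g)]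
    push Not
    rfl
  obtain ⟨Ω, hΩ⟩ := choice (σ := T2) fun Y => (huc Y).imp fun n => (key Y n).2
  exact ⟨Ω, fun Y f hf g hg h => (key Y _).1 (hΩ Y) f g hf hg h⟩

/-! ## Quantification over Baire space -/

theorem HasExists3.exists2 (h : M.HasExists3) : M.HasExists2 := by
  obtain ⟨E, -, hE⟩ := h
  refine hasExists2_of_dec (fun f => E ⋄ (lam fun g => f ⋄ (g ⋄ 0)) = 0) fun f => ?_
  rw [← hE]
  constructor
  · rintro ⟨n, hn⟩
    exact ⟨lam fun _ => n, by rw [lam_apply, lam_apply, hn]⟩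
  · rintro ⟨g, hg⟩
    rw [lam_apply] at hg
    exact ⟨_, hg⟩

theorem HasSuslin2.exists2 (h : M.HasSuslin2) : M.HasExists2 := by
  obtain ⟨S, -, hS⟩ := h
  -- The function given to `S` tests only the last entry of a sequence, and accepts the empty one. A
  -- path consists of zeros of `f`, and a zero repeated forever is a path.
  refine hasExists2_of_dec (fun f => S ⋄ (lam fun s => if s = 0 then 0 else f ⋄ (snd ⋄ (s - 1))) = 0)
    fun f => ?_
  rw [← hS]
  simp only [lam_apply]
  constructor
  · rintro ⟨m, hm⟩
    refine ⟨lam fun _ => m, fun n => ?_⟩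
    split_ifs with h0
    · rfl
    · have hn : n ≠ 0 := by
        rintro rfl
        exact h0 (seg_zero _)
      obtain ⟨k, rfl⟩ := exists_succ_of_ne_zero hn
      rw [seg_succ, add_tsub_cancel_right, snd_pr, lam_apply, hm]
  · rintro ⟨g, hg⟩
    have := hg (0 + 1)
    rw [seg_succ, if_neg (add_one_ne_zero' _), add_tsub_cancel_right, snd_pr] at this
    exact ⟨_, this⟩

/-- `(∃²)` absorbs the number quantifier, leaving a single quantifier over functions for `E`. -/
theorem HasExists3.suslin2 (h : M.HasExists3) : M.HasSuslin2 := by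
  obtain ⟨φ, -, hφ⟩ := h.exists2
  obtain ⟨E, hE1, hE⟩ := h
  refine ⟨lam fun f => E ⋄ (lam fun g => if φ ⋄ (lam fun n => if f ⋄ seg g n = 0 then 1 else 0) = 0
    then 1 else 0), fun f => ?_, fun f => ?_⟩
  · rw [lam_apply]
    exact hE1 _
  · rw [lam_apply, ← hE]
    refine exists_congr fun g => ?_
    rw [lam_apply]
    split_ifs with h
    · refine iff_of_false (fun h0 => ?_) zero_ne_one'.symm
      obtain ⟨n, hn⟩ := (hφ _).2 h
      rw [lam_apply, if_pos (h0 n)] at hn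
      exact zero_ne_one' hn.symm
    · refine iff_of_true (fun n => ?_) rfl
      by_contra h0
      exact h ((hφ _).1 ⟨n, by rw [lam_apply, if_neg h0]⟩)

/-- Choice improves `(∃²)` to a functional `μ` returning a zero whenever one exists. With `μ` every
function is recovered from its graph, a point of `C`, so quantification over all functions reduces
to `C`, where `κ` decides it. -/
theorem HasExists2.exists3 (h : M.HasExists2) (hκ : M.HasKappa3) : M.HasExists3 := by
  classical
  obtain ⟨φ, -, hφ⟩ := h
  obtain ⟨κ, hκ⟩ := hκ
  obtain ⟨μ, hμ⟩ := choice (σ := T1) (P := fun f n => φ ⋄ f = 0 → f ⋄ n = 0) fun f => by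
    by_cases hf : φ ⋄ f = 0
    · exact ((hφ f).2 hf).imp fun n hn _ => hn
    · exact ⟨0, fun h => (hf h).elim⟩
  have hsurj : ∀ g : M.D T1, ∃ f : M.D T1, InC f ∧
      (lam fun n => μ ⋄ (lam fun m => f ⋄ pr n m)) = g := fun g => by
    refine ⟨lam fun p => if snd ⋄ p = g ⋄ (fst ⋄ p) then 0 else 1, fun i => ?_, M.ext fun n => ?_⟩
    · rw [lam_apply]
      exact ite_le_one
    · rw [lam_apply]
      have := hμ (lam fun m => (lam fun p => if snd ⋄ p = g ⋄ (fst ⋄ p) then 0 else 1) ⋄ pr n m)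
        ((hφ _).1 ⟨g ⋄ n, by rw [lam_apply, lam_apply, snd_pr, fst_pr, if_pos rfl]⟩)
      rw [lam_apply, lam_apply, snd_pr, fst_pr] at this
      by_contra hne
      rw [if_neg hne] at this
      exact zero_ne_one' this.symm
  refine ⟨lam fun Y => if κ ⋄ (lam fun f => if Y ⋄ (lam fun n => μ ⋄ (lam fun m => f ⋄ pr n m)) = 0
    then 1 else 0) = 0 then 0 else 1, fun Y => ?_, fun Y => ?_⟩
  · rw [lam_apply]
    exact ite_le_one
  · have key : (∃ f, Y ⋄ f = 0) ↔ κ ⋄ (lam fun f =>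
        if Y ⋄ (lam fun n => μ ⋄ (lam fun m => f ⋄ pr n m)) = 0 then 1 else 0) = 0 := by
      rw [kappa_iff hκ]
      constructor
      · rintro ⟨g, hg⟩
        obtain ⟨f, hf, rfl⟩ := hsurj g
        exact ⟨f, hf, hg⟩
      · rintro ⟨f, -, hf⟩
        exact ⟨_, hf⟩
    rw [key, lam_apply]
    split_ifs with h
    · exact iff_of_true h rfl
    · exact iff_of_false h zero_ne_one'.symm

end

end Model

end HOArith

/-! ### Translation between the formal sentences and their meaning in a model. -/

namespace HOArith
open Structure

namespace Model

variable {M : Model} {Γ : Ctx} {σ τ υ : FinType}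

/-! ## The meaning of the principles in a model -/

theorem eval_app (ρ : M.Env Γ) (t : Term Γ (σ ⇾ τ)) (u : Term Γ σ) :
    M.eval ρ (t ⬝ u) = M.eval ρ t ⋄ M.eval ρ u := rfl

theorem eval_v0 (ρ : M.Env Γ) (a : M.D σ) : M.eval (.cons a ρ) v0 = a := rfl

theorem eval_v1 (ρ : M.Env Γ) (a : M.D σ) (b : M.D τ) : M.eval (.cons a (.cons b ρ)) v1 = b := rfl

theorem eval_v2 (ρ : M.Env Γ) (a : M.D σ) (b : M.D τ) (c : M.D υ) :
    M.eval (.cons a (.cons b (.cons c ρ))) v2 = c := rfl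

theorem eval_v3 {χ : FinType} (ρ : M.Env Γ) (a : M.D σ) (b : M.D τ) (c : M.D υ) (d : M.D χ) :
    M.eval (.cons a (.cons b (.cons c (.cons d ρ)))) v3 = d := rfl

theorem sat_leAt_one (ρ : M.Env Γ) (t : Term Γ (σ ⇾ T0)) :
    M.Sat ρ (leAt (σ ⇾ T0) t (oneAt (σ ⇾ T0))) ↔ ∀ x, M.eval ρ t ⋄ x ≤ 1 := by
  simp only [leAt, sat_all, sat_le, eval_app, eval_wk, eval_v0]
  refine forall_congr' fun x => Iff.of_eq (congrArg _ ?_)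
  exact combPi_apply _ _

theorem sat_inCantor (ρ : M.Env Γ) (f : Term Γ T1) :
    M.Sat ρ (inCantor f) ↔ InC (M.eval ρ f) := sat_leAt_one ρ f

theorem eval_pair (ρ : M.Env Γ) (x y : Term Γ T0) :
    M.eval ρ (pair x y) = pr (M.eval ρ x) (M.eval ρ y) := rfl

/-- The auxiliary function in the formal definition exists by primitive recursion and is unique by
induction. -/
theorem sat_isInitSeg (ρ : M.Env Γ) (f : Term Γ T1) (n s : Term Γ T0) :
    M.Sat ρ (isInitSeg f n s) ↔ seg (M.eval ρ f) (M.eval ρ n) = M.eval ρ s := by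
  simp only [isInitSeg, sat_ex, sat_and, sat_all, sat_eq, eval_app, eval_wk, eval_v0, eval_v1,
    eval_add, eval_zero, eval_one, eval_pair]
  constructor
  · rintro ⟨c, h0, hs, h⟩
    rw [← h, eq_seg h0 hs]
  · intro h
    refine ⟨lam fun n => seg (M.eval ρ f) n, ?_, fun n => ?_, ?_⟩
    · rw [lam_apply, seg_zero]
    · rw [lam_apply, lam_apply, seg_succ]
    · rw [lam_apply, h]

theorem sat_sameInitSeg (ρ : M.Env Γ) (f g : Term Γ T1) (n : Term Γ T0) :
    M.Sat ρ (sameInitSeg f g n) ↔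
      seg (M.eval ρ f) (M.eval ρ n) = seg (M.eval ρ g) (M.eval ρ n) := by
  simp only [sameInitSeg, sat_ex, sat_and, sat_isInitSeg, eval_wk, eval_v0]
  exact ⟨fun ⟨_, h, h'⟩ => h.trans h'.symm, fun h => ⟨_, h, rfl⟩⟩

theorem sat_zeroAtInitSeg (ρ : M.Env Γ) (h g : Term Γ T1) (n : Term Γ T0) :
    M.Sat ρ (zeroAtInitSeg h g n) ↔ M.eval ρ h ⋄ seg (M.eval ρ g) (M.eval ρ n) = 0 := by
  simp only [zeroAtInitSeg, sat_ex, sat_and, sat_isInitSeg, sat_eq, eval_wk, eval_v0, eval_app,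
    eval_zero]
  exact ⟨fun ⟨_, h, h'⟩ => h ▸ h', fun h => ⟨_, rfl, h⟩⟩

theorem sat_isBinSeq (ρ : M.Env Γ) (s : Term Γ T0) :
    M.Sat ρ (isBinSeq s) ↔ ∃ f : M.D T1, InC f ∧ ∃ n, M.eval ρ s = seg f n := by
  simp only [isBinSeq, sat_ex, sat_and, sat_inCantor, sat_isInitSeg, eval_wk, eval_v0, eval_v1,
    eq_comm]

theorem sat_isBinTree (ρ : M.Env Γ) (t : Term Γ T1) :
    M.Sat ρ (isBinTree t) ↔ IsTree (M.eval ρ t) := by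
  simp only [isBinTree, sat_and, sat_all, sat_imp, sat_eq, sat_le, sat_inCantor, sat_isBinSeq,
    sat_zeroAtInitSeg, eval_wk, eval_v0, eval_v1, eval_v2, eval_app, eval_zero, IsTree]

theorem sat_isInfinite (ρ : M.Env Γ) (t : Term Γ T1) :
    M.Sat ρ (isInfinite t) ↔ ∀ b, ∃ s, b < s ∧ M.eval ρ t ⋄ s = 0 := by
  simp only [isInfinite, sat_and, sat_all, sat_ex, sat_eq, sat_lt, eval_wk, eval_v0, eval_v1,
    eval_app, eval_zero]
  rfl

theorem sat_wkl : M.Sat .nil WKL ↔ M.HasWKL := by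
  simp only [WKL, isPath, sat_all, sat_imp, sat_ex, sat_and, sat_isBinTree, sat_isInfinite,
    sat_inCantor, sat_zeroAtInitSeg, eval_wk, eval_v0, eval_v1, HasWKL]

theorem sat_exists2 : M.Sat .nil Exists2 ↔ M.HasExists2 := by
  simp only [Exists2, sat_ex, sat_and, sat_all, sat_iff, sat_leAt_one, sat_eq, eval_v0, eval_v1,
    eval_app, eval_zero, HasExists2]

theorem sat_suslin2 : M.Sat .nil Suslin2 ↔ M.HasSuslin2 := by
  simp only [Suslin2, sat_ex, sat_and, sat_all, sat_iff, sat_leAt_one, sat_eq, sat_zeroAtInitSeg,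
    eval_v0, eval_v1, eval_v2, eval_app, eval_zero, HasSuslin2]

theorem sat_exists3 : M.Sat .nil Exists3 ↔ M.HasExists3 := by
  simp only [Exists3, sat_ex, sat_and, sat_all, sat_iff, sat_leAt_one, sat_eq, eval_v0, eval_v1,
    eval_app, eval_zero, HasExists3]

theorem sat_kappa3 : M.Sat .nil Kappa3 ↔ M.HasKappa3 := by
  simp only [Kappa3, sat_ex, sat_and, sat_all, sat_iff, sat_inCantor, sat_eq, sat_lt, eval_v0,
    eval_v1, eval_app, eval_zero, HasKappa3]
  rfl

theorem sat_muc : M.Sat .nil MUC ↔ M.HasMUC := by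
  simp only [MUC, sat_ex, sat_all, sat_imp, sat_inCantor, sat_sameInitSeg, sat_eq, eval_v0,
    eval_v1, eval_v2, eval_v3, eval_app, HasMUC]

end Model

end HOArith

theorem mainTheorem2 :
    HOArith.Proves HOArith.RCA0wQFAC20
      (HOArith.MUC.iff ((HOArith.Kappa3.and HOArith.WKL).and HOArith.Exists2.neg)) ∧
    HOArith.Proves HOArith.RCA0wQFAC20
      (((HOArith.Kappa3.and HOArith.WKL).and HOArith.Exists2.neg).iff
        ((HOArith.Kappa3.and HOArith.WKL).and HOArith.Suslin2.neg)) ∧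
    HOArith.Proves HOArith.RCA0wQFAC20
      (((HOArith.Kappa3.and HOArith.WKL).and HOArith.Suslin2.neg).iff
        ((HOArith.Kappa3.and HOArith.WKL).and HOArith.Exists3.neg)) := by
  refine ⟨HOArith.proves_of_forall_model fun M => ?_, HOArith.proves_of_forall_model fun M => ?_,
    HOArith.proves_of_forall_model fun M => ?_⟩ <;>
  simp only [HOArith.Structure.sat_iff, HOArith.Structure.sat_and, HOArith.Structure.sat_neg,
    HOArith.Model.sat_muc, HOArith.Model.sat_kappa3, HOArith.Model.sat_wkl,
    HOArith.Model.sat_exists2, HOArith.Model.sat_suslin2, HOArith.Model.sat_exists3]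
  · exact ⟨fun h => ⟨⟨h.kappa3, h.wkl⟩, h.not_exists2⟩,
      fun h => HOArith.Model.hasMUC_of_kappa3 h.1.1 h.1.2 h.2⟩
  -- The common conjunct supplies `(κ₀³)`, which is needed to climb from `(∃²)` to `(∃³)`; the way
  -- down is unconditional.
  · exact and_congr_right fun h => not_congr
      ⟨fun h2 => (h2.exists3 h.1).suslin2, fun h2 => h2.exists2⟩
  · exact and_congr_right fun h => not_congr
      ⟨fun h2 => h2.exists2.exists3 h.1, fun h2 => h2.suslin2⟩
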